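/- **Setting.** A discrete measurable groupoid is a groupoid $\mathscr G$ (identified with its set of arrows, with unit space $\mathscr G^0\subseteq\mathscr G$, source map $\mathfrak s$ and range map $\mathfrak r$, and with $xy$ defined when $\mathfrak s(x)=\mathfrak r(y)$) carrying a standard Borel structure such that $\mathscr G^0$ is Borel, the source, range, multiplication and inversion maps are Borel, and $\mathfrak s^{-1}(x)$ is countable for every $x\in\mathscr G^0$. A p.m.p. groupoid is such a $\mathscr G$ with a Borel probability measure $\mu$ on $\mathscr G^0$ such that $\int_{\mathscr G^0}|\mathfrak s^{-1}(x)\cap B|\,d\mu(x)=\int_{\mathscr G^0}|\mathfrak r^{-1}(x)\cap B|\,d\mu(x)$ for every Borel set $B\subseteq\mathscr G$; this common value defines a Borel measure on $\mathscr G$, also denoted $\mu$. It has infinite classes if $\mathfrak s^{-1}(x)$ is infinite for $\mu$-almost every $x\in\mathscr G^0$. For a Borel set $B\subseteq\mathscr G$ on which $\mathfrak s$ and $\mathfrak r$ are injective, let $s_B$ be the partial isometry on $L^2(\mathscr G,\mu)$ such that $(s_B\xi)(x)=\xi(y^{-1})$ if $y\in\mathfrak r^{-1}(\mathfrak s(x))$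 is the element with $xy\in B$, and $(s_B\xi)(x)=0$ if there is no such $y$. Let $I_{\mathscr G}$ be the set of all these $s_B$ (it is closed under products and adjoints), $[I_{\mathscr G}]$ its linear span, and $\tau(a)=\langle a1_{\mathscr G^0},1_{\mathscr G^0}\rangle$. Let $I_d\subseteq M_d(\mathbb C)$ be the set of partial permutation matrices, ${\rm tr}$ the normalized trace on $M_d(\mathbb C)$ and $\|a\|_2={\rm tr}(a^*a)^{1/2}$. For a finite set $F\subseteq I_{\mathscr G}$, integers $n,d\ge1$ and $\delta>0$, let ${\rm SA}(F,n,\delta,d)$ be the set of all linear maps $\varphi:[I_{\mathscr G}]\to M_d(\mathbb C)$ such that for all $1\le k\le n$ and $s_1,\dots,s_k\in F\cup F^*$ one has $\|\varphi(s_1\cdots s_k)-\varphi(s_1)\cdots\varphi(s_k)\|_2<\delta$, $\varphi(s_1\cdots s_k)\in I_d$ and $|{\rm tr}(\varphi(s_1\cdots s_k))-\tau(s_1\cdots s_k)|<\delta$. The groupoid is sofic if for all finite $F\subseteq I_{\mathscr G}$, $n\ge1$ and $\delta>0$ the set ${\rm SA}(F,n,\delta,d)$ is nonempty for some $d\ge1$.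 For a finite set $E\subseteq I_{\mathscr G}$ let $|{\rm SA}(F,n,\delta,d)|_E$ be the number of distinct restrictions $\varphi|_E$ with $\varphi\in{\rm SA}(F,n,\delta,d)$. The lower sofic dimension of $\mathscr G$ is $$\underline s(\mathscr G)=\sup_E\,\inf_F\,\inf_{n\ge1}\,\inf_{\delta>0}\,\liminf_{d\to\infty}\frac{\log|{\rm SA}(F,n,\delta,d)|_E}{d\log d}\in[-\infty,+\infty],$$ where $E$ and $F$ range over the finite subsets of $I_{\mathscr G}$ and $\log0=-\infty$, $\log\infty=\infty$. **Proposition.** If a p.m.p. groupoid $(\mathscr G,\mu)$ is sofic and has infinite classes, then $\underline s(\mathscr G)\ge1$. -/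

import Mathlib

open MeasureTheory Set Filter Topology
open scoped ENNReal

set_option linter.unusedSectionVars false

namespace SoficDim

/-! ### Counting points in fibres -/

section FibreCount

/-- A continuous image of Baire space is approximated from inside by compact sets. -/
theorem exists_isCompact_subset_range {Y : Type*} [TopologicalSpace Y] [PolishSpace Y]
    [MeasurableSpace Y] [BorelSpace Y] (μ : Measure Y) [IsFiniteMeasure μ]
    {f : (ℕ → ℕ) → Y} (hf : Continuous f) {c : ℝ≥0∞} (hc : c < μ (range f)) :
    ∃ K, IsCompact K ∧ K ⊆ range f ∧ c ≤ μ K := by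
  have step : ∀ (S : {S : Set (ℕ → ℕ) // c < μ (f '' S)}) (k : ℕ),
      ∃ m : ℕ, c < μ (f '' ((S : Set (ℕ → ℕ)) ∩ {x | x k ≤ m})) := by
    rintro ⟨S, hS⟩ k
    have hmono : Monotone fun m : ℕ => f '' (S ∩ {x | x k ≤ m}) := fun a b hab =>
      image_mono (inter_subset_inter_right _ fun x (hx : x k ≤ a) => hx.trans hab)
    have hU : (⋃ m : ℕ, f '' (S ∩ {x | x k ≤ m})) = f '' S := by
      rw [← image_iUnion, ← inter_iUnion]
      congr 1
      refine inter_eq_left.2 fun x _ => mem_iUnion.2 ⟨x k, le_refl (x k)⟩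
    rw [← hU, hmono.measure_iUnion] at hS
    exact lt_iSup_iff.1 hS
  choose m hm using step
  let T : ℕ → {S : Set (ℕ → ℕ) // c < μ (f '' S)} := fun k =>
    Nat.rec ⟨univ, by rwa [image_univ]⟩ (fun k S => ⟨_, hm S k⟩) k
  let n : ℕ → ℕ := fun k => m (T k) k
  have hT : ∀ k, (T k).1 = {x | ∀ i < k, x i ≤ n i} := by
    intro k
    induction k with
    | zero => simp [T]
    | succ k ih =>
      have : (T (k + 1)).1 = (T k).1 ∩ {x | x k ≤ n k} := rfl
      rw [this, ih]
      ext x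
      simp only [mem_inter_iff, mem_ofPred_eq]
      constructor
      · rintro ⟨h1, h2⟩ i hi
        rcases Nat.lt_succ_iff_lt_or_eq.1 hi with h | rfl
        · exact h1 i h
        · exact h2
      · exact fun h => ⟨fun i hi => h i (by omega), h k (by omega)⟩
  let K : Set (ℕ → ℕ) := univ.pi fun i => Iic (n i)
  have hK : IsCompact K := isCompact_univ_pi fun i => (finite_Iic (n i)).isCompact
  refine ⟨f '' K, hK.image hf, image_subset_range _ _, ?_⟩
  by_contra! hlt
  obtain ⟨U, hKU, hUo, hUc⟩ := (f '' K).exists_isOpen_lt_of_lt c hlt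
  have hex : ∀ k, ∃ x, x ∈ (T k).1 ∧ f x ∉ U := by
    intro k
    by_contra! h
    have : f '' (T k).1 ⊆ U := by
      rintro _ ⟨x, hx, rfl⟩
      exact h x hx
    exact absurd ((T k).2.trans_le (measure_mono this)) hUc.not_gt
  choose x hxT hxU using hex
  let y : ℕ → ℕ → ℕ := fun k i => min (x k i) (n i)
  have hyK : ∀ k, y k ∈ K := fun k i _ => mem_Iic.2 (min_le_right (x k i) (n i))
  obtain ⟨a, haK, φ, hφ, hlim⟩ := hK.tendsto_subseq hyK
  have hlim' : Tendsto (fun j => x (φ j)) atTop (𝓝 a) := by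
    rw [tendsto_pi_nhds] at hlim ⊢
    intro i
    refine (hlim i).congr' ?_
    filter_upwards [eventually_gt_atTop i] with j hj
    have h1 := hxT (φ j)
    rw [hT] at h1
    exact min_eq_left (h1 i (hj.trans_le (hφ.id_le j)))
  have haU : f a ∈ U := hKU ⟨a, haK, rfl⟩
  have hev := ((hf.tendsto a).comp hlim').eventually (hUo.mem_nhds haU)
  obtain ⟨j, hj⟩ := hev.exists
  exact hxU _ hj

/-- Analytic sets are universally measurable. -/
theorem nullMeasurableSet_of_analyticSet {Y : Type*} [TopologicalSpace Y] [PolishSpace Y]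
    [MeasurableSpace Y] [BorelSpace Y] (μ : Measure Y) [IsFiniteMeasure μ]
    {A : Set Y} (hA : AnalyticSet A) : NullMeasurableSet A μ := by
  rw [AnalyticSet] at hA
  rcases hA with rfl | ⟨f, hf, rfl⟩
  · exact nullMeasurableSet_empty
  rcases eq_or_ne (μ (range f)) 0 with h0 | h0
  · exact NullMeasurableSet.of_null h0
  obtain ⟨u, -, hu, hlim⟩ := exists_seq_strictMono_tendsto' (pos_iff_ne_zero.2 h0)
  choose K hKc hKs hKm using fun j => exists_isCompact_subset_range μ hf (hu j).2
  have hM : MeasurableSet (⋃ j, K j) := MeasurableSet.iUnion fun j => (hKc j).measurableSet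
  have hle : μ (range f) ≤ μ (⋃ j, K j) :=
    le_of_tendsto' hlim fun j => (hKm j).trans (measure_mono (subset_iUnion K j))
  exact hM.nullMeasurableSet.congr
    (ae_eq_of_subset_of_measure_ge (iUnion_subset hKs) hle hM.nullMeasurableSet
      (measure_ne_top _ _))

/-- The number of points of a Borel set in the fibres of a Borel map is almost everywhere
measurable as a function on the base. -/
theorem aemeasurable_fibreCount {X Y : Type*} [MeasurableSpace X] [StandardBorelSpace X]
    [MeasurableSpace Y] [StandardBorelSpace Y] (μ : Measure Y) [IsFiniteMeasure μ]
    {f : X → Y} (hf : Measurable f) {B : Set X} (hB : MeasurableSet B) :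
    AEMeasurable (fun y => ((f ⁻¹' {y} ∩ B).encard : ℝ≥0∞)) μ := by
  have key : ∀ k : ℕ, NullMeasurableSet {y | ((k + 1 : ℕ) : ℕ∞) ≤ (f ⁻¹' {y} ∩ B).encard} μ := by
    intro k
    let S : Set (Fin (k + 1) → X) :=
      {v | (∀ i, v i ∈ B) ∧ (∀ i j, f (v i) = f (v j)) ∧ ∀ i j, i ≠ j → v i ≠ v j}
    have hS : MeasurableSet S := by
      have e : S = (⋂ i, {v | v i ∈ B}) ∩ ((⋂ i, ⋂ j, {v | f (v i) = f (v j)}) ∩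
          ⋂ i, ⋂ j, {v | i ≠ j → v i ≠ v j}) := by
        ext v
        simp [S]
      rw [e]
      refine (MeasurableSet.iInter fun i => measurable_pi_apply i hB).inter
        ((MeasurableSet.iInter fun i => MeasurableSet.iInter fun j => ?_).inter
          (MeasurableSet.iInter fun i => MeasurableSet.iInter fun j => ?_))
      · exact measurableSet_eq_fun (hf.comp (measurable_pi_apply i))
          (hf.comp (measurable_pi_apply j))
      · by_cases hij : i = j
        · simp [hij]
        · have h : MeasurableSet {v : Fin (k + 1) → X | v i = v j}ᶜ :=
            (measurableSet_eq_fun (measurable_pi_apply i) (measurable_pi_apply j)).compl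
          convert h using 1
          ext v
          simp [hij]
    have himg : {y | ((k + 1 : ℕ) : ℕ∞) ≤ (f ⁻¹' {y} ∩ B).encard} = (fun v => f (v 0)) '' S := by
      ext y
      constructor
      · intro hy
        obtain ⟨t, ht, htc⟩ := exists_subset_encard_eq hy
        have htf : t.Finite := finite_of_encard_eq_coe htc
        have hcard : htf.toFinset.card = k + 1 := by
          have := htf.encard_eq_coe_toFinset_card
          rw [htc] at this
          exact_mod_cast this.symm
        let e := (htf.toFinset.equivFinOfCardEq hcard).symm
        have het : ∀ i, (e i : X) ∈ t := fun i => htf.mem_toFinset.1 (e i).2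
        refine ⟨fun i => e i, ⟨fun i => (ht (het i)).2, fun i j => ?_, fun i j hij => ?_⟩,
          (ht (het 0)).1⟩
        · exact ((ht (het i)).1 : f _ = y).trans ((ht (het j)).1 : f _ = y).symm
        · exact fun h => hij (e.injective (Subtype.ext h))
      · rintro ⟨v, ⟨h1, h2, h3⟩, rfl⟩
        have hinj : Function.Injective v := fun i j h => by
          by_contra hij
          exact h3 i j hij h
        have hsub : range v ⊆ f ⁻¹' {f (v 0)} ∩ B := by
          rintro _ ⟨i, rfl⟩
          exact ⟨h2 i 0, h1 i⟩
        refine le_trans ?_ (encard_le_encard hsub)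
        rw [← image_univ, hinj.encard_image, encard_univ]
        simp
    rw [himg]
    let _ := upgradeStandardBorel Y
    exact nullMeasurableSet_of_analyticSet μ
      (hS.analyticSet_image (hf.comp (measurable_pi_apply 0)))
  have hsum : (fun y => ((f ⁻¹' {y} ∩ B).encard : ℝ≥0∞)) = fun y => ∑' k : ℕ,
      {y | ((k + 1 : ℕ) : ℕ∞) ≤ (f ⁻¹' {y} ∩ B).encard}.indicator (fun _ => (1 : ℝ≥0∞)) y := by
    funext y
    simp only [indicator, mem_ofPred_eq]
    generalize (f ⁻¹' {y} ∩ B).encard = e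
    induction e using ENat.recTopCoe with
    | top => simp
    | coe n =>
      rw [tsum_eq_sum (s := Finset.range n)]
      · rw [Finset.sum_congr rfl fun k hk => if_pos _]
        · simp
        · intro k hk
          have := Finset.mem_range.1 hk
          exact_mod_cast this
      · intro k hk
        rw [if_neg]
        have := Finset.mem_range.not.1 hk
        exact_mod_cast this
  rw [hsum]
  exact AEMeasurable.tsum fun k => aemeasurable_const.indicator₀ (key k)

theorem encard_inter_iUnion {X : Type*} (A : Set X) {B : ℕ → Set X}
    (hB : Pairwise (Function.onFun Disjoint B)) :
    ((A ∩ ⋃ i, B i).encard : ℝ≥0∞) = ∑' i, ((A ∩ B i).encard : ℝ≥0∞) := by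
  let _ : MeasurableSpace X := ⊤
  simp only [← Measure.count_apply MeasurableSpace.measurableSet_top]
  rw [inter_iUnion]
  exact measure_iUnion (fun i j hij => (hB hij).mono inter_subset_right inter_subset_right)
    fun _ => MeasurableSpace.measurableSet_top

end FibreCount

/-! ### Discrete measurable groupoids -/

/-- A groupoid, given by its set `G` of arrows. The units are the arrows `x` with `src x = x`.
The product `mul x y` is defined when `src x = rng y`; the value of the function `mul` at other
pairs carries no information. -/
class SetGroupoid (G : Type*) where
  src : G → G
  rng : G → G
  mul : G → G → G
  inv : G → G
  src_src : ∀ x, src (src x) = src x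
  rng_src : ∀ x, rng (src x) = src x
  src_rng : ∀ x, src (rng x) = rng x
  rng_rng : ∀ x, rng (rng x) = rng x
  src_mul : ∀ x y, src x = rng y → src (mul x y) = src y
  rng_mul : ∀ x y, src x = rng y → rng (mul x y) = rng x
  mul_assoc : ∀ x y z, src x = rng y → src y = rng z → mul (mul x y) z = mul x (mul y z)
  rng_mul_self : ∀ x, mul (rng x) x = x
  mul_src_self : ∀ x, mul x (src x) = x
  src_inv : ∀ x, src (inv x) = rng x
  rng_inv : ∀ x, rng (inv x) = src x
  mul_inv_self : ∀ x, mul x (inv x) = rng x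
  inv_mul_self : ∀ x, mul (inv x) x = src x

open SetGroupoid

/-- The unit space `G⁰`. -/
def unitSpace (G : Type*) [SetGroupoid G] : Set G := {x | src x = x}

/-- A discrete measurable groupoid: a groupoid with a standard Borel structure such that the unit
space and the structure maps are Borel and the source map has countable fibres. -/
class DiscreteMeasurableGroupoid (G : Type*) [MeasurableSpace G] [SetGroupoid G] : Prop
    extends StandardBorelSpace G where
  measurableSet_unitSpace : MeasurableSet (unitSpace G)
  measurable_src : Measurable (src : G → G)
  measurable_rng : Measurable (rng : G → G)
  measurable_mul : Measurable fun p : {p : G × G // src p.1 = rng p.2} => mul p.1.1 p.1.2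
  measurable_inv : Measurable (inv : G → G)
  countable_src_fibre : ∀ x ∈ unitSpace G, (src ⁻¹' {x} : Set G).Countable

open DiscreteMeasurableGroupoid

variable {G : Type*} [MeasurableSpace G] [SetGroupoid G] [DiscreteMeasurableGroupoid G]

/-- A probability-measure-preserving groupoid: a Borel probability measure `μ` on the unit space
such that `∫ |s⁻¹(x) ∩ B| dμ(x) = ∫ |r⁻¹(x) ∩ B| dμ(x)` for all Borel sets `B` of arrows. -/
class IsPMP (μ : Measure (unitSpace G)) : Prop extends IsProbabilityMeasure μ where
  lintegral_src_eq_lintegral_rng : ∀ B : Set G, MeasurableSet B →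
    ∫⁻ x : unitSpace G, ((src ⁻¹' {(x : G)} ∩ B).encard : ℝ≥0∞) ∂μ =
      ∫⁻ x : unitSpace G, ((rng ⁻¹' {(x : G)} ∩ B).encard : ℝ≥0∞) ∂μ

theorem aemeasurable_srcCount (μ : Measure (unitSpace G)) [IsFiniteMeasure μ] {B : Set G}
    (hB : MeasurableSet B) :
    AEMeasurable (fun x : unitSpace G => ((src ⁻¹' {(x : G)} ∩ B).encard : ℝ≥0∞)) μ := by
  have : StandardBorelSpace (unitSpace G) := measurableSet_unitSpace.standardBorel
  let f : G → unitSpace G := fun x => ⟨src x, src_src x⟩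
  have hf : Measurable f := measurable_src.subtype_mk
  have h := aemeasurable_fibreCount μ hf hB
  have e : ∀ x : unitSpace G, f ⁻¹' {x} = src ⁻¹' {(x : G)} := by
    intro x
    ext g
    simp [f, Subtype.ext_iff]
  simpa only [e] using h

/-- The measure on the groupoid induced by a measure `μ` on the unit space, whose value at a Borel
set `B` is `∫ |s⁻¹(x) ∩ B| dμ(x)`. -/
noncomputable def arrowMeasure (μ : Measure (unitSpace G)) [IsFiniteMeasure μ] : Measure G :=
  Measure.ofMeasurable
    (fun B _ => ∫⁻ x : unitSpace G, ((src ⁻¹' {(x : G)} ∩ B).encard : ℝ≥0∞) ∂μ)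
    (by simp)
    (fun B hB hd => by
      simp only [encard_inter_iUnion _ hd]
      exact lintegral_tsum fun i => aemeasurable_srcCount μ (hB i))

theorem arrowMeasure_apply (μ : Measure (unitSpace G)) [IsFiniteMeasure μ] {B : Set G}
    (hB : MeasurableSet B) :
    arrowMeasure μ B = ∫⁻ x : unitSpace G, ((src ⁻¹' {(x : G)} ∩ B).encard : ℝ≥0∞) ∂μ :=
  Measure.ofMeasurable_apply B hB

theorem arrowMeasure_unitSpace (μ : Measure (unitSpace G)) [IsFiniteMeasure μ] :
    arrowMeasure μ (unitSpace G) = μ univ := by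
  rw [arrowMeasure_apply μ measurableSet_unitSpace]
  have : ∀ x : unitSpace G, src ⁻¹' {(x : G)} ∩ unitSpace G = {(x : G)} := by
    intro x
    ext g
    simp only [mem_inter_iff, mem_preimage, mem_singleton_iff]
    constructor
    · rintro ⟨h1, h2⟩
      exact (show src g = g from h2).symm.trans h1
    · rintro rfl
      exact ⟨x.2, x.2⟩
  simp [this]

/-! ### Bisections and the inverse semigroup of partial isometries -/

/-- A Borel set of arrows on which the source and range maps are injective. -/
structure Bisection (G : Type*) [MeasurableSpace G] [SetGroupoid G] where
  carrier : Set G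
  measurableSet : MeasurableSet carrier
  injOn_src : InjOn src carrier
  injOn_rng : InjOn rng carrier

section Algebra

variable {G : Type*} [SetGroupoid G]

theorem inv_inv (x : G) : inv (inv x) = x := by
  have h1 : mul (mul (inv (inv x)) (inv x)) x = mul (inv (inv x)) (mul (inv x) x) :=
    mul_assoc _ _ _ (src_inv _) (src_inv _)
  rw [inv_mul_self, inv_mul_self, src_inv, rng_mul_self, ← rng_inv x, ← src_inv, mul_src_self] at h1
  exact h1.symm

theorem inv_mul_cancel {x y : G} (h : src x = rng y) : mul (inv x) (mul x y) = y := by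
  rw [← mul_assoc _ _ _ (src_inv x) h, inv_mul_self, h, rng_mul_self]

theorem mul_inv_cancel {x y : G} (h : rng x = rng y) : mul x (mul (inv x) y) = y := by
  rw [← mul_assoc _ _ _ (rng_inv x).symm ((src_inv x).trans h), mul_inv_self, h, rng_mul_self]

theorem mul_inv_rev {x y : G} (h : src x = rng y) : inv (mul x y) = mul (inv y) (inv x) := by
  have h0 : src (inv y) = rng (inv x) := by rw [src_inv, rng_inv, h]
  have h1 : mul (mul x y) (mul (inv y) (inv x)) = rng (mul x y) := by
    rw [mul_assoc _ _ _ h (by rw [rng_mul _ _ h0, rng_inv]),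
      mul_inv_cancel (by rw [rng_inv, h]), mul_inv_self, rng_mul _ _ h]
  have h2 : src (mul x y) = rng (mul (inv y) (inv x)) := by
    rw [src_mul _ _ h, rng_mul _ _ h0, rng_inv]
  have h3 := inv_mul_cancel h2
  rw [h1, ← src_inv, mul_src_self] at h3
  exact h3

open Classical in
/-- The operator `s_B` on functions: `(s_B ξ)(x) = ξ(y⁻¹)` where `y` is the element of
`r⁻¹(s(x))` with `xy ∈ B`, and `0` if there is no such `y`. -/
noncomputable def translate (B : Set G) (ξ : G → ℂ) (x : G) : ℂ :=
  if h : ∃ y, rng y = src x ∧ mul x y ∈ B then ξ (inv h.choose) else 0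

theorem translate_of_mem {B : Set G} (hB : InjOn rng B) (ξ : G → ℂ) {b x : G} (hb : b ∈ B)
    (h : rng b = rng x) : translate B ξ x = ξ (mul (inv b) x) := by
  have hc : src (inv x) = rng b := (src_inv x).trans h.symm
  have hex : ∃ y, rng y = src x ∧ mul x y ∈ B :=
    ⟨mul (inv x) b, by rw [rng_mul _ _ hc, rng_inv], by rwa [mul_inv_cancel h.symm]⟩
  have hy := hex.choose_spec
  have e : mul x hex.choose = b := hB hy.2 hb (by rw [rng_mul _ _ hy.1.symm, h])
  rw [translate, dif_pos hex]
  congr 1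
  have e2 : hex.choose = mul (inv x) b := by
    rw [← e, inv_mul_cancel hy.1.symm]
  rw [e2, mul_inv_rev hc, inv_inv]

theorem translate_of_forall_ne {B : Set G} (ξ : G → ℂ) {x : G}
    (h : ∀ b ∈ B, rng b ≠ rng x) : translate B ξ x = 0 := by
  rw [translate, dif_neg]
  rintro ⟨y, hy, hyB⟩
  exact h _ hyB (rng_mul _ _ hy.symm)

end Algebra

section Translate

namespace Bisection

/-- The set of arrows whose range lies in `r(B)`. -/
def dom (B : Bisection G) : Set G := rng ⁻¹' (rng '' B.carrier)

theorem measurableSet_dom (B : Bisection G) : MeasurableSet B.dom :=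
  measurable_rng (B.measurableSet.image_of_measurable_injOn measurable_rng B.injOn_rng)

/-- The inverse bisection. -/
def inverse (B : Bisection G) : Bisection G where
  carrier := inv ⁻¹' B.carrier
  measurableSet := measurable_inv B.measurableSet
  injOn_src x hx y hy h := by
    rw [← inv_inv x, ← inv_inv y]
    exact congrArg inv (B.injOn_rng hx hy (by rw [rng_inv, rng_inv, h]))
  injOn_rng x hx y hy h := by
    rw [← inv_inv x, ← inv_inv y]
    exact congrArg inv (B.injOn_src hx hy (by rw [src_inv, src_inv, h]))

theorem inverse_inverse (B : Bisection G) : B.inverse.inverse = B := by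
  cases B
  simp [inverse, preimage_preimage, inv_inv]

/-- The unit space as a bisection. -/
def unit (G : Type*) [MeasurableSpace G] [SetGroupoid G] [DiscreteMeasurableGroupoid G] :
    Bisection G where
  carrier := unitSpace G
  measurableSet := measurableSet_unitSpace
  injOn_src x hx y hy h := by
    rw [← show src x = x from hx, ← show src y = y from hy, h]
  injOn_rng x hx y hy h := by
    rw [← show src x = x from hx, ← show src y = y from hy, ← rng_src x, ← rng_src y,
      show src x = x from hx, show src y = y from hy, h]

/-- The product of two bisections, consisting of all products of their elements. -/
def prod (B C : Bisection G) : Bisection G where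
  carrier := {z | ∃ x ∈ B.carrier, ∃ y ∈ C.carrier, src x = rng y ∧ mul x y = z}
  measurableSet := by
    have hs : MeasurableSet {p : G × G | src p.1 = rng p.2} :=
      measurableSet_eq_fun (measurable_src.comp measurable_fst) (measurable_rng.comp measurable_snd)
    have : StandardBorelSpace {p : G × G // src p.1 = rng p.2} := hs.standardBorel
    have hS : MeasurableSet {p : {p : G × G // src p.1 = rng p.2} |
        p.1.1 ∈ B.carrier ∧ p.1.2 ∈ C.carrier} :=
      ((measurable_fst.comp measurable_subtype_coe) B.measurableSet).inter
        ((measurable_snd.comp measurable_subtype_coe) C.measurableSet)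
    have himg : MeasurableSet ((fun p : {p : G × G // src p.1 = rng p.2} => mul p.1.1 p.1.2) ''
        {p | p.1.1 ∈ B.carrier ∧ p.1.2 ∈ C.carrier}) := by
      refine hS.image_of_measurable_injOn measurable_mul ?_
      rintro ⟨⟨x, y⟩, h⟩ ⟨hx, hy⟩ ⟨⟨x', y'⟩, h'⟩ ⟨hx', hy'⟩ e
      simp only at h h' hx hy hx' hy' e
      have ex : x = x' := B.injOn_rng hx hx' (by rw [← rng_mul _ _ h, e, rng_mul _ _ h'])
      have ey : y = y' := C.injOn_src hy hy' (by rw [← src_mul _ _ h, e, src_mul _ _ h'])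
      subst ex ey
      rfl
    convert himg using 1
    ext z
    constructor
    · rintro ⟨x, hx, y, hy, h, rfl⟩
      exact ⟨⟨(x, y), h⟩, ⟨hx, hy⟩, rfl⟩
    · rintro ⟨⟨⟨x, y⟩, h⟩, ⟨hx, hy⟩, rfl⟩
      exact ⟨x, hx, y, hy, h, rfl⟩
  injOn_src := by
    rintro _ ⟨x, hx, y, hy, h, rfl⟩ _ ⟨x', hx', y', hy', h', rfl⟩ e
    rw [src_mul _ _ h, src_mul _ _ h'] at e
    have ey := C.injOn_src hy hy' e
    subst ey
    have ex := B.injOn_src hx hx' (h.trans h'.symm)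
    subst ex
    rfl
  injOn_rng := by
    rintro _ ⟨x, hx, y, hy, h, rfl⟩ _ ⟨x', hx', y', hy', h', rfl⟩ e
    rw [rng_mul _ _ h, rng_mul _ _ h'] at e
    have ex := B.injOn_rng hx hx' e
    subst ex
    have ey := C.injOn_rng hy hy' (h.symm.trans h')
    subst ey
    rfl

open Classical in
/-- The map `x ↦ b⁻¹x`, where `b` is the element of `B` with the same range as `x`, extended by
the identity. -/
noncomputable def shift {G : Type*} [MeasurableSpace G] [SetGroupoid G] (B : Bisection G) (x : G) : G :=
  if h : ∃ b ∈ B.carrier, rng b = rng x then mul (inv h.choose) x else x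

theorem shift_of_mem {G : Type*} [MeasurableSpace G] [SetGroupoid G] (B : Bisection G) {b x : G} (hb : b ∈ B.carrier) (h : rng b = rng x) :
    B.shift x = mul (inv b) x := by
  have hex : ∃ b ∈ B.carrier, rng b = rng x := ⟨b, hb, h⟩
  have e : hex.choose = b :=
    B.injOn_rng hex.choose_spec.1 hb (hex.choose_spec.2.trans h.symm)
  rw [shift, dif_pos hex, e]

theorem translate_eq_indicator (B : Bisection G) (ξ : G → ℂ) :
    translate B.carrier ξ = B.dom.indicator (ξ ∘ B.shift) := by
  funext x
  by_cases hx : x ∈ B.dom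
  · obtain ⟨b, hb, h⟩ := hx
    rw [translate_of_mem B.injOn_rng ξ hb h, indicator_of_mem (show x ∈ B.dom from ⟨b, hb, h⟩),
      Function.comp, B.shift_of_mem hb h]
  · rw [indicator_of_notMem hx, translate_of_forall_ne]
    exact fun b hb h => hx ⟨b, hb, h⟩

theorem measurable_shift (B : Bisection G) : Measurable B.shift := by
  refine measurable_of_restrict_of_restrict_compl B.measurableSet_dom ?_ ?_
  · have hex : ∀ x : B.dom, ∃ b ∈ B.carrier, rng b = rng (x : G) := fun x => x.2
    choose β hβ hβr using hex
    have hm : Measurable β := by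
      intro N hN
      have e : β ⁻¹' N = (fun x : B.dom => rng (x : G)) ⁻¹' (rng '' (B.carrier ∩ N)) := by
        ext x
        constructor
        · exact fun hx => ⟨β x, ⟨hβ x, hx⟩, hβr x⟩
        · rintro ⟨b, ⟨hb, hbN⟩, h⟩
          have : β x = b := B.injOn_rng (hβ x) hb ((hβr x).trans h.symm)
          rw [mem_preimage, this]
          exact hbN
      rw [e]
      exact (measurable_rng.comp measurable_subtype_coe)
        ((B.measurableSet.inter hN).image_of_measurable_injOn measurable_rng
          (B.injOn_rng.mono inter_subset_left))
    have e : B.dom.domRestrict B.shift = (fun p : {p : G × G // src p.1 = rng p.2} => mul p.1.1 p.1.2) ∘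
        fun x : B.dom => ⟨(inv (β x), (x : G)), (src_inv _).trans (hβr x)⟩ := by
      funext x
      exact B.shift_of_mem (hβ x) (hβr x)
    rw [e]
    exact measurable_mul.comp
      (((measurable_inv.comp hm).prodMk measurable_subtype_coe).subtype_mk)
  · have e : B.domᶜ.domRestrict B.shift = Subtype.val := by
      funext x
      exact dif_neg x.2
    rw [e]
    exact measurable_subtype_coe

theorem src_shift (B : Bisection G) (x : G) : src (B.shift x) = src x := by
  by_cases h : ∃ b ∈ B.carrier, rng b = rng x
  · obtain ⟨b, hb, h⟩ := h
    rw [B.shift_of_mem hb h, src_mul _ _ ((src_inv b).trans h)]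
  · rw [shift, dif_neg h]

theorem shift_mem_dom (B : Bisection G) {x : G} (hx : x ∈ B.dom) : B.shift x ∈ B.inverse.dom := by
  obtain ⟨b, hb, h⟩ := hx
  rw [B.shift_of_mem hb h]
  exact ⟨inv b, by rwa [inverse, mem_preimage, inv_inv],
    (rng_mul _ _ ((src_inv b).trans h)).symm⟩

theorem shift_shift (B : Bisection G) {x : G} (hx : x ∈ B.dom) :
    B.inverse.shift (B.shift x) = x := by
  obtain ⟨b, hb, h⟩ := hx
  have hc := (src_inv b).trans h
  have hb' : inv b ∈ B.inverse.carrier := by rwa [inverse, mem_preimage, inv_inv]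
  rw [B.shift_of_mem hb h, B.inverse.shift_of_mem hb' (rng_mul _ _ hc).symm, inv_inv,
    mul_inv_cancel h]

theorem measurePreserving_shift (B : Bisection G) (μ : Measure (unitSpace G)) [IsFiniteMeasure μ] :
    MeasurePreserving B.shift ((arrowMeasure μ).restrict B.dom)
      ((arrowMeasure μ).restrict B.inverse.dom) := by
  refine ⟨B.measurable_shift, ?_⟩
  ext N hN
  rw [Measure.map_apply B.measurable_shift hN, Measure.restrict_apply (B.measurable_shift hN),
    Measure.restrict_apply hN, arrowMeasure_apply μ ((B.measurable_shift hN).inter B.measurableSet_dom),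
    arrowMeasure_apply μ (hN.inter B.inverse.measurableSet_dom)]
  congr 1
  funext x
  have hinj : InjOn B.shift (src ⁻¹' {(x : G)} ∩ (B.shift ⁻¹' N ∩ B.dom)) := by
    intro a ha b hb h
    rw [← B.shift_shift ha.2.2, h, B.shift_shift hb.2.2]
  rw [← hinj.encard_image]
  congr 2
  ext y
  constructor
  · rintro ⟨a, ⟨h1, h2, h3⟩, rfl⟩
    exact ⟨(B.src_shift a).trans h1, h2, B.shift_mem_dom h3⟩
  · rintro ⟨h1, h2, h3⟩
    have hy : B.shift (B.inverse.shift y) = y := by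
      have := B.inverse.shift_shift h3
      rwa [inverse_inverse] at this
    refine ⟨B.inverse.shift y, ⟨(B.inverse.src_shift y).trans h1, ?_, ?_⟩, hy⟩
    · rwa [mem_preimage, hy]
    · have := B.inverse.shift_mem_dom h3
      rwa [inverse_inverse] at this

variable (μ : Measure (unitSpace G)) [IsFiniteMeasure μ]

theorem translate_congr (B : Bisection G) {ξ η : G → ℂ} (h : ξ =ᵐ[arrowMeasure μ] η) :
    translate B.carrier ξ =ᵐ[arrowMeasure μ] translate B.carrier η := by
  rw [translate_eq_indicator, translate_eq_indicator]
  have h1 : ξ =ᵐ[(arrowMeasure μ).restrict B.inverse.dom] η := ae_restrict_of_ae h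
  have h2 := (B.measurePreserving_shift μ).quasiMeasurePreserving.ae_eq_comp h1
  exact (ae_eq_restrict_iff_indicator_ae_eq B.measurableSet_dom).1 h2

theorem eLpNorm_translate_le (B : Bisection G) {ξ : G → ℂ}
    (hξ : AEStronglyMeasurable ξ (arrowMeasure μ)) :
    eLpNorm (translate B.carrier ξ) 2 (arrowMeasure μ) ≤ eLpNorm ξ 2 (arrowMeasure μ) := by
  rw [translate_eq_indicator, eLpNorm_indicator_eq_eLpNorm_restrict B.measurableSet_dom,
    eLpNorm_comp_measurePreserving hξ.restrict (B.measurePreserving_shift μ)]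
  exact eLpNorm_mono_measure _ Measure.restrict_le_self

theorem memLp_translate (B : Bisection G) {ξ : G → ℂ} (hξ : MemLp ξ 2 (arrowMeasure μ)) :
    MemLp (translate B.carrier ξ) 2 (arrowMeasure μ) := by
  refine ⟨?_, (B.eLpNorm_translate_le μ hξ.1).trans_lt hξ.2⟩
  rw [translate_eq_indicator]
  exact (aestronglyMeasurable_indicator_iff B.measurableSet_dom).2
    (hξ.1.restrict.comp_measurePreserving (B.measurePreserving_shift μ))

theorem translate_add (B : Bisection G) (ξ η : G → ℂ) :
    translate B.carrier (ξ + η) = translate B.carrier ξ + translate B.carrier η := by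
  simp only [translate_eq_indicator, ← indicator_add']
  rfl

theorem translate_smul (B : Bisection G) (c : ℂ) (ξ : G → ℂ) :
    translate B.carrier (c • ξ) = c • translate B.carrier ξ := by
  simp only [translate_eq_indicator]
  exact indicator_const_smul B.dom c (ξ ∘ B.shift)

/-- The partial isometry `s_B` on `L²(G, μ)`. -/
noncomputable def toOperator (B : Bisection G) :
    Lp ℂ 2 (arrowMeasure μ) →L[ℂ] Lp ℂ 2 (arrowMeasure μ) :=
  LinearMap.mkContinuous
    { toFun := fun ξ => (B.memLp_translate μ (Lp.memLp ξ)).toLp (translate B.carrier ξ)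
      map_add' := fun ξ η => by
        rw [← MemLp.toLp_add, MemLp.toLp_eq_toLp_iff, ← translate_add]
        exact B.translate_congr μ (Lp.coeFn_add ξ η)
      map_smul' := fun c ξ => by
        rw [RingHom.id_apply, ← MemLp.toLp_const_smul, MemLp.toLp_eq_toLp_iff, ← translate_smul]
        exact B.translate_congr μ (Lp.coeFn_smul c ξ) }
    1 fun ξ => by
      rw [one_mul, LinearMap.coe_mk, AddHom.coe_mk, Lp.norm_toLp, Lp.norm_def]
      exact ENNReal.toReal_mono (Lp.eLpNorm_ne_top ξ)
        (B.eLpNorm_translate_le μ (Lp.aestronglyMeasurable ξ))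

theorem coeFn_toOperator (B : Bisection G) (ξ : Lp ℂ 2 (arrowMeasure μ)) :
    (B.toOperator μ ξ : G → ℂ) =ᵐ[arrowMeasure μ] translate B.carrier ξ :=
  MemLp.coeFn_toLp (B.memLp_translate μ (Lp.memLp ξ))

theorem toOperator_unit : (unit G).toOperator μ = 1 := by
  ext1 ξ
  refine Lp.ext ((coeFn_toOperator μ _ ξ).trans (Eventually.of_forall fun x => ?_))
  have hr : rng x ∈ (unit G).carrier := src_rng x
  rw [translate_of_mem (unit G).injOn_rng ξ hr (rng_rng x)]
  have : inv (rng x) = rng x := by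
    have h := inv_mul_self (rng x)
    rw [src_rng] at h
    have h2 : src (inv (rng x)) = rng x := by rw [src_inv, rng_rng]
    have h3 := mul_src_self (inv (rng x))
    rwa [h2, h, eq_comm] at h3
  rw [this, rng_mul_self]
  rfl

theorem toOperator_prod (B C : Bisection G) :
    (B.prod C).toOperator μ = B.toOperator μ * C.toOperator μ := by
  ext1 ξ
  refine Lp.ext ((coeFn_toOperator μ _ ξ).trans ?_)
  refine EventuallyEq.trans ?_ (coeFn_toOperator μ B (C.toOperator μ ξ)).symm
  refine EventuallyEq.trans ?_ (B.translate_congr μ (coeFn_toOperator μ C ξ)).symm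
  refine Eventually.of_forall fun x => ?_
  by_cases hx : ∃ b ∈ B.carrier, rng b = rng x
  · obtain ⟨b, hb, h⟩ := hx
    have hbx : src (inv b) = rng x := (src_inv b).trans h
    rw [translate_of_mem B.injOn_rng _ hb h]
    by_cases hy : ∃ c ∈ C.carrier, rng c = rng (mul (inv b) x)
    · obtain ⟨c, hc, h'⟩ := hy
      have hbc : src b = rng c := by rw [h', rng_mul _ _ hbx, rng_inv]
      have hm : mul b c ∈ (B.prod C).carrier := ⟨b, hb, c, hc, hbc, rfl⟩
      rw [translate_of_mem C.injOn_rng _ hc h', translate_of_mem (B.prod C).injOn_rng _ hm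
        ((rng_mul _ _ hbc).trans h), mul_inv_rev hbc, mul_assoc _ _ _ _ hbx]
      rw [src_inv, rng_inv, hbc]
    · rw [translate_of_forall_ne (B := C.carrier) _ fun c hc h' => hy ⟨c, hc, h'⟩,
        translate_of_forall_ne]
      rintro _ ⟨b', hb', c, hc, hbc, rfl⟩ e
      rw [rng_mul _ _ hbc] at e
      have : b' = b := B.injOn_rng hb' hb (e.trans h.symm)
      subst this
      exact hy ⟨c, hc, by rw [rng_mul _ _ hbx, rng_inv, hbc]⟩
  · rw [translate_of_forall_ne (B := B.carrier) _ fun b hb h => hx ⟨b, hb, h⟩,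
      translate_of_forall_ne]
    rintro _ ⟨b, hb, c, hc, hbc, rfl⟩ e
    rw [rng_mul _ _ hbc] at e
    exact hx ⟨b, hb, e⟩

theorem toOperator_inverse (B : Bisection G) :
    B.inverse.toOperator μ = star (B.toOperator μ) := by
  rw [ContinuousLinearMap.star_eq_adjoint, ContinuousLinearMap.eq_adjoint_iff]
  intro ξ η
  rw [L2.inner_def, L2.inner_def]
  have hl : (fun x => inner ℂ (B.inverse.toOperator μ ξ x) (η x)) =ᵐ[arrowMeasure μ]
      B.inverse.dom.indicator fun x => inner ℂ (ξ (B.inverse.shift x)) (η x) := by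
    filter_upwards [coeFn_toOperator μ B.inverse ξ] with x hx
    rw [hx, translate_eq_indicator]
    by_cases h : x ∈ B.inverse.dom <;> simp [h]
  have hr : (fun x => inner ℂ (ξ x) (B.toOperator μ η x)) =ᵐ[arrowMeasure μ]
      B.dom.indicator fun x => inner ℂ (ξ x) (η (B.shift x)) := by
    filter_upwards [coeFn_toOperator μ B η] with x hx
    rw [hx, translate_eq_indicator]
    by_cases h : x ∈ B.dom <;> simp [h]
  rw [integral_congr_ae hl, integral_congr_ae hr, integral_indicator B.inverse.measurableSet_dom,
    integral_indicator B.measurableSet_dom]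
  have hmp := B.measurePreserving_shift μ
  have hmp' := B.inverse.measurePreserving_shift μ
  rw [inverse_inverse] at hmp'
  have hg : AEStronglyMeasurable (fun x => inner ℂ (ξ (B.inverse.shift x)) (η x))
      ((arrowMeasure μ).restrict B.inverse.dom) :=
    ((Lp.aestronglyMeasurable ξ).restrict.comp_measurePreserving hmp').inner
      (Lp.aestronglyMeasurable η).restrict
  rw [← hmp.map_eq] at hg ⊢
  rw [integral_map hmp.measurable.aemeasurable hg]
  refine setIntegral_congr_fun B.measurableSet_dom fun x hx => ?_
  simp only [B.shift_shift hx]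

end Bisection

end Translate

/-! ### The inverse semigroup `I_G`, its linear span and the trace -/

section InverseSemigroup

variable (μ : Measure (unitSpace G)) [IsFiniteMeasure μ]

/-- The collection `I_G` of all partial isometries `s_B` on `L²(G, μ)`, where `B` is a Borel set
of arrows on which source and range are injective. It is closed under products and adjoints. -/
noncomputable def inverseSemigroup : Submonoid (Lp ℂ 2 (arrowMeasure μ) →L[ℂ] Lp ℂ 2 (arrowMeasure μ)) where
  carrier := range fun B : Bisection G => B.toOperator μ
  mul_mem' := by
    rintro _ _ ⟨B, rfl⟩ ⟨C, rfl⟩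
    exact ⟨B.prod C, B.toOperator_prod μ C⟩
  one_mem' := ⟨Bisection.unit G, Bisection.toOperator_unit μ⟩

/-- The inverse in `I_G` is the adjoint. -/
noncomputable instance : Star (inverseSemigroup μ) where
  star s := ⟨star s.1, by
    obtain ⟨B, hB⟩ := s.2
    exact ⟨B.inverse, by rw [← hB]; exact B.toOperator_inverse μ⟩⟩

/-- The linear span `[I_G]` of `I_G` in the bounded operators on `L²(G, μ)`. -/
noncomputable def linSpan : Submodule ℂ (Lp ℂ 2 (arrowMeasure μ) →L[ℂ] Lp ℂ 2 (arrowMeasure μ)) :=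
  Submodule.span ℂ (inverseSemigroup μ : Set (Lp ℂ 2 (arrowMeasure μ) →L[ℂ] Lp ℂ 2 (arrowMeasure μ)))

variable {μ} in
/-- The inclusion of `I_G` in `[I_G]`. -/
noncomputable def toSpan (s : inverseSemigroup μ) : linSpan μ := ⟨s.1, Submodule.subset_span s.2⟩

/-- The characteristic function of the unit space as an element of `L²(G, μ)`. -/
noncomputable def unitVector : Lp ℂ 2 (arrowMeasure μ) :=
  indicatorConstLp 2 (measurableSet_unitSpace (G := G))
    (by rw [arrowMeasure_unitSpace]; exact measure_ne_top μ univ) 1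

/-- The trace `τ(a) = ⟨a 1_{G⁰}, 1_{G⁰}⟩`, with Mathlib's inner product being linear in the second
variable. -/
noncomputable def trace (a : Lp ℂ 2 (arrowMeasure μ) →L[ℂ] Lp ℂ 2 (arrowMeasure μ)) : ℂ :=
  inner ℂ (unitVector μ) (a (unitVector μ))

end InverseSemigroup

/-! ### Finite models -/

/-- The inverse semigroup `I_d` of partial permutation matrices. -/
def partialPermMatrices (d : ℕ) : Set (Matrix (Fin d) (Fin d) ℂ) :=
  range fun σ : Fin d ≃. Fin d => (σ.toMatrix : Matrix (Fin d) (Fin d) ℂ)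

/-- The normalized trace on `M_d`. -/
noncomputable def normTrace {d : ℕ} (M : Matrix (Fin d) (Fin d) ℂ) : ℂ := M.trace / d

open scoped Matrix in
/-- The `2`-norm `tr(M* M)^{1/2}` on `M_d`. -/
noncomputable def normTwo {d : ℕ} (M : Matrix (Fin d) (Fin d) ℂ) : ℝ :=
  Real.sqrt (normTrace (Mᴴ * M)).re

section Dimension

variable (μ : Measure (unitSpace G)) [IsFiniteMeasure μ]

variable {μ} in
/-- `F ∪ F*`. -/
noncomputable def symm (F : Finset (inverseSemigroup μ)) : Set (inverseSemigroup μ) :=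
  (F : Set (inverseSemigroup μ)) ∪ star '' (F : Set (inverseSemigroup μ))

variable {μ} in
/-- The set `SA(F, n, δ, d)` of all linear maps `φ : [I_G] → M_d` which are
`(F ∪ F*, n, δ)`-approximately multiplicative, send all products `s₁ ⋯ s_k` with `1 ≤ k ≤ n` and
`s_i ∈ F ∪ F*` into `I_d`, and preserve the trace of each such product up to `δ`. -/
def SA (F : Finset (inverseSemigroup μ)) (n : ℕ) (δ : ℝ) (d : ℕ) :
    Set (linSpan μ →ₗ[ℂ] Matrix (Fin d) (Fin d) ℂ) :=
  {φ | ∀ l : List (inverseSemigroup μ), 1 ≤ l.length → l.length ≤ n → (∀ s ∈ l, s ∈ symm F) →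
    normTwo (φ (toSpan l.prod) - (l.map fun s => φ (toSpan s)).prod) < δ ∧
    φ (toSpan l.prod) ∈ partialPermMatrices d ∧
    ‖normTrace (φ (toSpan l.prod)) - trace μ (l.prod : inverseSemigroup μ).1‖ < δ}

/-- Soficity. -/
def IsSofic : Prop :=
  ∀ (F : Finset (inverseSemigroup μ)) (n : ℕ) (δ : ℝ), 0 < δ → ∃ d : ℕ, 1 ≤ d ∧ (SA F n δ d).Nonempty

variable {μ} in
/-- `|SA(F, n, δ, d)|_E`, the number of restrictions to `E` of elements of `SA(F, n, δ, d)`. -/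
noncomputable def countSA (E F : Finset (inverseSemigroup μ)) (n : ℕ) (δ : ℝ) (d : ℕ) : ℕ∞ :=
  ((fun φ : linSpan μ →ₗ[ℂ] Matrix (Fin d) (Fin d) ℂ => fun s : E => φ (toSpan s.1)) ''
    SA F n δ d).encard

variable {μ} in
/-- `liminf_{d → ∞} (d log d)⁻¹ log |SA(F, n, δ, d)|_E`, with `log 0 = -∞`. -/
noncomputable def lowerDimAt (E F : Finset (inverseSemigroup μ)) (n : ℕ) (δ : ℝ) : EReal :=
  liminf (fun d : ℕ => ENNReal.log (countSA E F n δ d : ℝ≥0∞) / ((d * Real.log d : ℝ) : EReal))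
    atTop

variable {μ} in
/-- The infimum of `lowerDimAt E F n δ` over `n ≥ 1` and `δ > 0`. -/
noncomputable def lowerDimOf (E F : Finset (inverseSemigroup μ)) : EReal :=
  ⨅ (n : ℕ) (_ : 1 ≤ n) (δ : ℝ) (_ : 0 < δ), lowerDimAt E F n δ

variable {μ} in
/-- The lower sofic dimension of a subset `Ω` of `I_G`: the supremum over finite `E ⊆ Ω` of the
infimum over finite `F ⊆ Ω`. -/
noncomputable def lowerDim (Ω : Set (inverseSemigroup μ)) : EReal :=
  ⨆ (E : Finset (inverseSemigroup μ)) (_ : (E : Set (inverseSemigroup μ)) ⊆ Ω),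
    ⨅ (F : Finset (inverseSemigroup μ)) (_ : (F : Set (inverseSemigroup μ)) ⊆ Ω), lowerDimOf E F

/-- The lower sofic dimension of the groupoid, that is, of `I_G`. -/
noncomputable def lowerSoficDim : EReal := lowerDim (univ : Set (inverseSemigroup μ))

/-- The fibre `s⁻¹(x)` is infinite for almost every unit `x`. -/
def HasInfiniteClasses (μ : Measure (unitSpace G)) : Prop :=
  ∀ᵐ x : unitSpace G ∂μ, (src ⁻¹' {(x : G)} : Set G).Infinite

end Dimension

end SoficDim

namespace SoficDim

open SetGroupoid DiscreteMeasurableGroupoid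

/-! Fix `c > 0`. It suffices to find one finite set `E` such that, for all `F`, `n`, `δ` and all
large `d`, the models of dimension `d` have at least about `d ^ ((1 - c) * d)` restrictions to `E`.
The restrictions counted are the conjugates of a single model by permutation matrices, so the
question is how many permutations give the same conjugate.

Choose `m` with `1 / m ≤ c / 3`. Since almost every source fibre is infinite, almost all of the unit
space splits into Borel sets `Y n`, each the common source of `m` disjoint bisections
(`exists_disjoint_bisections`). Invariance of the measure enters here: it makes the range
multiplicities of a Borel section of the source map finite. Finitely many `Y n` cover all but `c /
9` of the unit space, and `E` consists of the partial isometries of their bisections.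

These satisfy `s* s = p`, with `p` the projection of `Y n`, and `τ(s* t) = 0` for distinct `s`, `t`
over the same `Y n`. In a good model the relations hold exactly at most points `v` of `Fin d`, and
there they force `v` to have `m` distinct images under `E` (`card_few_images_le`). The graph on `Fin
d` whose edges are the moves under `E` thus has at most `d / m + k` components, with `k ≤ c / 3 *
d`. Two permutations giving the same conjugate agree on a whole component once they agree at one of
its points, so at most `d ^ (d / m + k)` permutations give the same conjugate
(`card_conj_fibre_le`). Hence there are at least `d! / d ^ (d / m + k)` conjugates, and `d! ≥ (d /
e) ^ d` gives the exponent (`le_log_div_of_factorial_le`). Soficity provides a model in every large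
dimension by amplification (`eventually_SA_nonempty`). -/

/-! ### Measurable selection -/

section Selection

/-- The least element of the set of indices `k` with `y ∈ S k` depends on `y` in a null measurable
way. -/
theorem nullMeasurableSet_sInf_eq {Y : Type*} [MeasurableSpace Y] (μ : Measure Y) {S : ℕ → Set Y}
    (hS : ∀ k, NullMeasurableSet (S k) μ) (k : ℕ) :
    NullMeasurableSet {y | sInf {j | y ∈ S j} = k} μ := by
  -- The second piece accounts for the default value `sInf ∅ = 0`.
  have e : {y | sInf {j | y ∈ S j} = k} = (S k ∩ ⋂ j ∈ {j | j < k}, (S j)ᶜ) ∪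
      ({_y : Y | k = 0} ∩ ⋂ j, (S j)ᶜ) := by
    ext y
    simp only [mem_ofPred_eq, mem_union, mem_inter_iff, mem_iInter, mem_compl_iff]
    constructor
    · rintro rfl
      rcases Set.eq_empty_or_nonempty {j | y ∈ S j} with h | h
      · refine Or.inr ⟨by rw [h, Nat.sInf_empty], fun j hj => ?_⟩
        exact (h ▸ hj : j ∈ (∅ : Set ℕ))
      · exact Or.inl ⟨Nat.sInf_mem h, fun j hj => Nat.notMem_of_lt_sInf hj⟩
    · rintro (⟨h1, h2⟩ | ⟨rfl, h2⟩)
      · refine le_antisymm (Nat.sInf_le h1) (le_of_not_gt fun h => ?_)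
        exact h2 _ h (Nat.sInf_mem (s := {j | y ∈ S j}) ⟨k, h1⟩)
      · have : {j | y ∈ S j} = ∅ := eq_empty_of_forall_notMem h2
        rw [this, Nat.sInf_empty]
  rw [e]
  refine ((hS k).inter (NullMeasurableSet.biInter (to_countable _) fun j _ => (hS j).compl)).union
    ((MeasurableSet.const _).nullMeasurableSet.inter
      (NullMeasurableSet.iInter fun j => (hS j).compl))

/-- A Borel map between standard Borel spaces has a Borel section on almost all of its range. -/
theorem exists_measurable_ae_section {X Y : Type*} [MeasurableSpace X] [StandardBorelSpace X]
    [Nonempty X] [MeasurableSpace Y] [StandardBorelSpace Y] (μ : Measure Y) [IsFiniteMeasure μ]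
    {f : X → Y} (hf : Measurable f) :
    ∃ h : Y → X, Measurable h ∧ ∀ᵐ y ∂μ, y ∈ range f → f (h y) = y := by
  let _ := upgradeStandardBorel X
  let _ := upgradeStandardBorel Y
  -- Baire space is mapped onto the graph of `f` rather than onto `X`. Both coordinates are then
  -- continuous, although `f` need not be continuous for the chosen topologies.
  have hgr : AnalyticSet ((fun x => (x, f x)) '' univ) :=
    MeasurableSet.univ.analyticSet_image (measurable_id.prodMk hf)
  rw [image_univ, AnalyticSet] at hgr
  obtain hgr | ⟨F, hF, hFr⟩ := hgr
  · exact absurd hgr (range_nonempty _).ne_empty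
  let g : (ℕ → ℕ) → Y := fun z => (F z).2
  have hg : Continuous g := continuous_snd.comp hF
  have hfg : ∀ z, f (F z).1 = g z := by
    intro z
    obtain ⟨x, hx⟩ : F z ∈ range fun x => (x, f x) := hFr ▸ mem_range_self z
    simp only [g, ← hx]
  have hsurj : range f ⊆ range g := by
    rintro _ ⟨x, rfl⟩
    obtain ⟨z, hz⟩ : (x, f x) ∈ range F := hFr ▸ mem_range_self x
    exact ⟨z, by simp only [g, hz]⟩
  let A : ℕ → List ℕ → Set Y := fun n u => g '' {z | PiNat.res z n = u}
  have hA : ∀ n u, NullMeasurableSet (A n u) μ := by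
    intro n u
    refine nullMeasurableSet_of_analyticSet μ (IsOpen.analyticSet_image ?_ hg)
    rw [isOpen_iff_mem_nhds]
    intro z hz
    refine mem_of_superset ((PiNat.isOpen_cylinder (fun _ => ℕ) z n).mem_nhds
      (PiNat.self_mem_cylinder z n)) ?_
    rw [PiNat.cylinder_eq_res]
    exact fun w hw => (show PiNat.res w n = PiNat.res z n from hw).trans hz
  -- The leftmost branch over `y`: each step takes the least digit for which `y` still lies in the
  -- image of the cylinder. `PiNat.res` lists the newest digit first, so `k :: u` extends `u`.
  let pre : ℕ → Y → List ℕ := fun n y =>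
    Nat.rec [] (fun n u => sInf {k | y ∈ A (n + 1) (k :: u)} :: u) n
  have hpre : ∀ n y, pre (n + 1) y = sInf {k | y ∈ A (n + 1) (k :: pre n y)} :: pre n y :=
    fun _ _ => rfl
  have hpreM : ∀ n u, NullMeasurableSet {y | pre n y = u} μ := by
    intro n
    induction n with
    | zero => exact fun u => (MeasurableSet.const ([] = u)).nullMeasurableSet
    | succ n ih =>
      rintro (_ | ⟨k, u⟩)
      · simp [hpre]
      · have e : {y | pre (n + 1) y = k :: u} =
            {y | pre n y = u} ∩ {y | sInf {j | y ∈ A (n + 1) (j :: u)} = k} := by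
          ext y
          simp only [hpre, List.cons.injEq, mem_ofPred_eq, mem_inter_iff]
          constructor
          · rintro ⟨h1, h2⟩
            rw [h2] at h1
            exact ⟨h2, h1⟩
          · rintro ⟨h1, h2⟩
            rw [h1]
            exact ⟨h2, rfl⟩
        rw [e]
        exact (ih u).inter (nullMeasurableSet_sInf_eq μ (fun j => hA _ _) k)
  let L : Y → ℕ → ℕ := fun y n => sInf {k | y ∈ A (n + 1) (k :: pre n y)}
  have hpreL : ∀ n y, pre n y = PiNat.res (L y) n := by
    intro n y
    induction n with
    | zero => rfl
    | succ n ih => rw [hpre, PiNat.res_succ, ← ih]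
  have hL : AEMeasurable L μ := by
    refine aemeasurable_pi_iff.2 fun n => NullMeasurable.aemeasurable fun t _ => ?_
    have e : (fun y => L y n) ⁻¹' t = ⋃ k ∈ t, ⋃ u, {y | pre (n + 1) y = k :: u} := by
      ext y
      simp only [mem_preimage, mem_iUnion, mem_ofPred_eq, hpre, List.cons.injEq]
      exact ⟨fun h => ⟨_, h, _, rfl, rfl⟩, by rintro ⟨k, hk, u, rfl, -⟩; exact hk⟩
    rw [e]
    exact NullMeasurableSet.biUnion (to_countable t) fun k _ =>
      NullMeasurableSet.iUnion fun u => hpreM (n + 1) (k :: u)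
  have hsec : ∀ y ∈ range f, g (L y) = y := by
    intro y hy
    have hex : ∀ n, y ∈ A n (pre n y) := by
      intro n
      induction n with
      | zero =>
        obtain ⟨z, hz⟩ := hsurj hy
        exact ⟨z, rfl, hz⟩
      | succ n ih =>
        obtain ⟨z, hz, hzy⟩ := ih
        have : (z n) ∈ {k | y ∈ A (n + 1) (k :: pre n y)} :=
          ⟨z, by rw [← show PiNat.res z n = pre n y from hz]; rfl, hzy⟩
        exact Nat.sInf_mem ⟨_, this⟩
    -- The points `z n` lie over `y` and share longer and longer prefixes with `L y`, so continuity
    -- of `g` gives `g (L y) = y`.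
    choose z hz hzy using hex
    have hlim : Tendsto z atTop (𝓝 (L y)) := by
      rw [tendsto_pi_nhds]
      intro i
      refine tendsto_const_nhds.congr' ?_
      filter_upwards [eventually_gt_atTop i] with n hn
      have := (show PiNat.res (z n) n = pre n y from hz n).trans (hpreL n y)
      exact (PiNat.res_eq_res.1 this hn).symm
    have h := (hg.tendsto _).comp hlim
    refine tendsto_nhds_unique h ?_
    simp only [Function.comp_def, hzy, tendsto_const_nhds]
  refine ⟨fun y => (F (hL.mk L y)).1,
    (continuous_fst.comp hF).measurable.comp hL.measurable_mk, ?_⟩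
  filter_upwards [hL.ae_eq_mk] with y hy hyf
  rw [hfg, ← hy, hsec y hyf]

end Selection

/-! ### Disjoint bisections with a common source -/

section Bisections

/-- Finitely many Borel maps with almost surely finite fibres become injective on the members of a
countable Borel cover. -/
theorem exists_cover_injOn {ι X Z : Type*} [Finite ι] [MeasurableSpace X] [StandardBorelSpace X]
    [MeasurableSpace Z] [StandardBorelSpace Z] (μ : Measure X) [IsFiniteMeasure μ] {θ : ι → X → Z}
    (hθ : ∀ i, Measurable (θ i)) {P : Set X} (hP : MeasurableSet P)
    (hfin : ∀ᵐ x ∂μ, x ∈ P ∧ ∀ i, {x' ∈ P | θ i x' = θ i x}.Finite) :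
    ∃ D : ℕ → Set X, (∀ n, MeasurableSet (D n)) ∧ (∀ n, D n ⊆ P) ∧
      (∀ n i, InjOn (θ i) (D n)) ∧ ∀ᵐ x ∂μ, x ∈ ⋃ n, D n := by
  let _ := upgradeStandardBorel X
  obtain ⟨b, hbc, -, hb⟩ := TopologicalSpace.exists_countable_basis X
  rcases b.eq_empty_or_nonempty with rfl | hne
  · refine ⟨fun _ => ∅, by simp, by simp, by simp, Eventually.of_forall fun x => ?_⟩
    obtain ⟨v, hv, -⟩ := hb.exists_subset_of_mem_open (mem_univ x) isOpen_univ
    exact hv.elim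
  obtain ⟨U, hU⟩ := hbc.exists_eq_range hne
  have hUo : ∀ n, IsOpen (U n) := fun n => hb.isOpen (hU ▸ mem_range_self n)
  -- The points of `U n ∩ P` sharing no value `θ i` with another point of `U n ∩ P`. The removed
  -- projections are only analytic, hence the passage to Borel subsets `D n` of full measure in `V
  -- n`.
  let V : ℕ → Set X := fun n =>
    (U n ∩ P) \ ⋃ i, Prod.fst '' {p : X × X | p.1 ≠ p.2 ∧ θ i p.1 = θ i p.2 ∧ p.2 ∈ U n ∩ P}
  have hV : ∀ n, NullMeasurableSet (V n) μ := by
    intro n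
    refine ((hUo n).measurableSet.inter hP).nullMeasurableSet.diff
      (NullMeasurableSet.iUnion fun i => nullMeasurableSet_of_analyticSet μ ?_)
    refine MeasurableSet.analyticSet_image ?_ measurable_fst
    exact (measurableSet_eq_fun measurable_fst measurable_snd).compl.inter
      ((measurableSet_eq_fun ((hθ i).comp measurable_fst) ((hθ i).comp measurable_snd)).inter
        (measurable_snd ((hUo n).measurableSet.inter hP)))
  choose D hDV hDm hDe using fun n => (hV n).exists_measurable_subset_ae_eq
  refine ⟨D, hDm, fun n x hx => (hDV n hx).1.2, fun n i x hx y hy h => ?_, ?_⟩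
  · by_contra hxy
    exact (hDV n hx).2 (mem_iUnion.2 ⟨i, (x, y), ⟨hxy, h, (hDV n hy).1⟩, rfl⟩)
  · have hae : ∀ᵐ x ∂μ, ∀ n, x ∈ V n → x ∈ D n := by
      refine ae_all_iff.2 fun n => ?_
      filter_upwards [hDe n] with x hx h
      exact (show D n x ↔ V n x from iff_of_eq hx).2 h
    filter_upwards [hae, hfin] with x hx hxf
    -- The other points in the fibres of `x` form a finite, hence closed, set, so some basic
    -- neighbourhood `U n` of `x` avoids them and `x ∈ V n`.
    have hF : (⋃ i, {x' ∈ P | θ i x' = θ i x} \ {x}).Finite :=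
      finite_iUnion fun i => (hxf.2 i).subset sdiff_subset
    have hxF : x ∈ (⋃ i, {x' ∈ P | θ i x' = θ i x} \ {x})ᶜ := by simp
    obtain ⟨v, hv, hxv, hvF⟩ := hb.exists_subset_of_mem_open hxF hF.isClosed.isOpen_compl
    rw [hU] at hv
    obtain ⟨n, rfl⟩ := hv
    refine mem_iUnion.2 ⟨n, hx n ⟨⟨hxv, hxf.1⟩, fun h => ?_⟩⟩
    obtain ⟨i, ⟨x₁, x'⟩, ⟨h1, h2, h3⟩, rfl⟩ := mem_iUnion.1 h
    exact hvF h3.1 (mem_iUnion.2 ⟨i, ⟨h3.2, h2.symm⟩, fun h => h1 (mem_singleton_iff.1 h).symm⟩)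

variable {G : Type*} [MeasurableSpace G] [SetGroupoid G] [DiscreteMeasurableGroupoid G]

theorem standardBorelSpace_unitSpace : StandardBorelSpace (unitSpace G) :=
  measurableSet_unitSpace.standardBorel

theorem aemeasurable_rngCount (μ : Measure (unitSpace G)) [IsFiniteMeasure μ] {B : Set G}
    (hB : MeasurableSet B) :
    AEMeasurable (fun x : unitSpace G => ((rng ⁻¹' {(x : G)} ∩ B).encard : ℝ≥0∞)) μ := by
  have := standardBorelSpace_unitSpace (G := G)
  let f : G → unitSpace G := fun x => ⟨rng x, src_rng x⟩
  have hf : Measurable f := measurable_rng.subtype_mk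
  have h := aemeasurable_fibreCount μ hf hB
  have e : ∀ x : unitSpace G, f ⁻¹' {x} = rng ⁻¹' {(x : G)} := by
    intro x
    ext g
    simp [f, Subtype.ext_iff]
  simpa only [e] using h

/-- If almost every source fibre is infinite, then one can choose any finite number of distinct
arrows in almost every source fibre in a Borel way. -/
theorem exists_measurable_distinct_arrows (μ : Measure (unitSpace G)) [IsProbabilityMeasure μ]
    (hinf : HasInfiniteClasses μ) (m : ℕ) :
    ∃ h : unitSpace G → Fin m → G, Measurable h ∧
      ∀ᵐ x ∂μ, (∀ j, src (h x j) = x) ∧ ∀ i j, i ≠ j → h x i ≠ h x j := by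
  have := standardBorelSpace_unitSpace (G := G)
  let S : Set (unitSpace G × (Fin m → G)) :=
    {p | (∀ j, src (p.2 j) = p.1) ∧ ∀ i j, i ≠ j → p.2 i ≠ p.2 j}
  have hS : MeasurableSet S := by
    have e : S = (⋂ j, {p | src (p.2 j) = p.1}) ∩ ⋂ i, ⋂ j, {p | i ≠ j → p.2 i ≠ p.2 j} := by
      ext p
      simp [S]
    rw [e]
    refine (MeasurableSet.iInter fun j => measurableSet_eq_fun
      (measurable_src.comp ((measurable_pi_apply j).comp measurable_snd))
      (measurable_subtype_coe.comp measurable_fst)).inter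
      (MeasurableSet.iInter fun i => MeasurableSet.iInter fun j => ?_)
    by_cases hij : i = j
    · simp [hij]
    · simp only [hij, ne_eq, not_false_eq_true, forall_const]
      exact (measurableSet_eq_fun ((measurable_pi_apply i).comp measurable_snd)
        ((measurable_pi_apply j).comp measurable_snd)).compl
  have hex : ∀ x : unitSpace G, (src ⁻¹' {(x : G)} : Set G).Infinite → ∃ v, (x, v) ∈ S := by
    intro x hx
    let e := hx.natEmbedding
    exact ⟨fun j => e j, fun j => (e j).2, fun i j hij h =>
      hij (Fin.ext (e.injective (Subtype.ext h)))⟩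
  have : StandardBorelSpace S := hS.standardBorel
  have : Nonempty S := by
    obtain ⟨x, hx⟩ := Eventually.exists hinf
    obtain ⟨v, hv⟩ := hex x hx
    exact ⟨⟨_, hv⟩⟩
  obtain ⟨h, hm, hh⟩ := exists_measurable_ae_section μ
    (f := fun p : S => p.1.1) (measurable_fst.comp measurable_subtype_coe)
  refine ⟨fun x => (h x).1.2, measurable_snd.comp (measurable_subtype_coe.comp hm), ?_⟩
  filter_upwards [hh, hinf] with x hx hxi
  obtain ⟨v, hv⟩ := hex x hxi
  have e := hx ⟨⟨_, hv⟩, rfl⟩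
  have := (h x).2
  exact ⟨fun j => (this.1 j).trans (congrArg Subtype.val e), this.2⟩

/-- In a p.m.p. groupoid, the ranges of the arrows in the image of a Borel section of the source
map almost surely have finite multiplicity. -/
theorem ae_finite_rng_fibre (μ : Measure (unitSpace G)) [IsPMP μ] {h : unitSpace G → G}
    (hm : Measurable h) {P : Set (unitSpace G)} (hP : MeasurableSet P)
    (hs : ∀ x ∈ P, src (h x) = x) :
    ∀ᵐ x ∂μ, x ∈ P → {x' ∈ P | rng (h x') = rng (h x)}.Finite := by
  have := standardBorelSpace_unitSpace (G := G)
  have hinj : InjOn h P := fun x hx y hy e =>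
    Subtype.ext ((hs x hx).symm.trans ((congrArg src e).trans (hs y hy)))
  have hA : MeasurableSet (h '' P) := hP.image_of_measurable_injOn hm hinj
  have hle : ∀ x : unitSpace G, ((src ⁻¹' {(x : G)} ∩ h '' P).encard : ℝ≥0∞) ≤ 1 := by
    intro x
    have : (src ⁻¹' {(x : G)} ∩ h '' P).encard ≤ 1 := by
      rw [encard_le_one_iff]
      rintro _ _ ⟨h1, a, ha, rfl⟩ ⟨h2, b, hb, rfl⟩
      have e : (a : G) = b := by
        rw [← hs a ha, ← hs b hb]
        exact h1.trans h2.symm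
      rw [Subtype.ext e]
    exact_mod_cast this
  -- The image of a section has at most one arrow per source, so its measure is at most `1`; counted
  -- by ranges, the same measure bounds the multiplicities on average.
  have hfin : ∫⁻ x : unitSpace G, ((rng ⁻¹' {(x : G)} ∩ h '' P).encard : ℝ≥0∞) ∂μ ≠ ⊤ := by
    rw [← IsPMP.lintegral_src_eq_lintegral_rng _ hA]
    refine ((lintegral_mono hle).trans_lt ?_).ne
    simp
  let N := toMeasurable μ {x : unitSpace G | ¬ ((rng ⁻¹' {(x : G)} ∩ h '' P).encard : ℝ≥0∞) < ⊤}
  have hN : μ N = 0 := by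
    rw [measure_toMeasurable]
    exact ae_iff.1 (ae_lt_top' (aemeasurable_rngCount μ hA) hfin)
  -- The exceptional null set `N` consists of ranges, while the claim is about almost every source.
  -- Invariance applied to the arrows ending in `N` transfers nullity from ranges to sources.
  let B : Set G := h '' P ∩ (fun g => (⟨rng g, src_rng g⟩ : unitSpace G)) ⁻¹' N
  have hB : MeasurableSet B := hA.inter
    (measurable_rng.subtype_mk (measurableSet_toMeasurable _ _))
  have hB0 : ∫⁻ x : unitSpace G, ((src ⁻¹' {(x : G)} ∩ B).encard : ℝ≥0∞) ∂μ = 0 := by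
    rw [IsPMP.lintegral_src_eq_lintegral_rng _ hB,
      lintegral_eq_zero_iff' (aemeasurable_rngCount μ hB)]
    filter_upwards [measure_eq_zero_iff_ae_notMem.1 hN] with x hx
    have : rng ⁻¹' {(x : G)} ∩ B = ∅ := by
      refine eq_empty_of_forall_notMem fun g hg => hx ?_
      have e : (⟨rng g, src_rng g⟩ : unitSpace G) = x := Subtype.ext hg.1
      exact e ▸ hg.2.2
    simp [this]
  rw [lintegral_eq_zero_iff' (aemeasurable_srcCount μ hB)] at hB0
  filter_upwards [hB0] with x hx hxP
  have hx' : src ⁻¹' {(x : G)} ∩ B = ∅ := by simpa using hx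
  have hxN : (⟨rng (h x), src_rng (h x)⟩ : unitSpace G) ∉ N := fun hN =>
    (hx' ▸ ⟨hs x hxP, ⟨x, hxP, rfl⟩, hN⟩ : h x ∈ (∅ : Set G))
  have hlt := not_not.1 fun hn => hxN (subset_toMeasurable μ _ hn)
  have hf : (rng ⁻¹' {rng (h x)} ∩ h '' P).Finite := by
    rw [← encard_lt_top_iff]
    simpa using hlt
  refine Finite.of_finite_image (f := h) (hf.subset ?_) (hinj.mono fun y hy => hy.1)
  rintro _ ⟨y, hy, rfl⟩
  exact ⟨hy.2, y, hy.1, rfl⟩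

/-- A p.m.p. groupoid with infinite classes has, for every `m`, a countable Borel partition of a
conull subset of the unit space such that every member of the partition is the common source of
`m` disjoint bisections. -/
theorem exists_disjoint_bisections (μ : Measure (unitSpace G)) [IsPMP μ]
    (hinf : HasInfiniteClasses μ) (m : ℕ) :
    ∃ (Y : ℕ → Set (unitSpace G)) (C : ℕ → Fin m → Bisection G),
      (∀ n, MeasurableSet (Y n)) ∧ Pairwise (Function.onFun Disjoint Y) ∧
      (∀ᵐ x ∂μ, x ∈ ⋃ n, Y n) ∧ (∀ n j, src '' (C n j).carrier = Subtype.val '' Y n) ∧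
      ∀ n i j, i ≠ j → Disjoint (C n i).carrier (C n j).carrier := by
  have := standardBorelSpace_unitSpace (G := G)
  obtain ⟨h, hm, hh⟩ := exists_measurable_distinct_arrows μ hinf m
  have hmj : ∀ j, Measurable fun x => h x j := fun j => (measurable_pi_apply j).comp hm
  obtain ⟨P, hP, hPm, hPe⟩ : ∃ P : Set (unitSpace G),
      (∀ x ∈ P, (∀ j, src (h x j) = x) ∧ ∀ i j, i ≠ j → h x i ≠ h x j) ∧ MeasurableSet P ∧
        ∀ᵐ x ∂μ, x ∈ P := by
    refine ⟨(toMeasurable μ {x | ¬ ((∀ j, src (h x j) = x) ∧ ∀ i j, i ≠ j → h x i ≠ h x j)})ᶜ,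
      fun x hx => not_not.1 fun hn => hx (subset_toMeasurable μ _ hn),
      (measurableSet_toMeasurable _ _).compl, measure_eq_zero_iff_ae_notMem.1 ?_⟩
    rw [measure_toMeasurable]
    exact ae_iff.1 hh
  -- Sources along a section are injective automatically; the cover makes the ranges of all `m`
  -- sections injective at once.
  obtain ⟨D, hDm, hDP, hDi, hDc⟩ := exists_cover_injOn μ (θ := fun j x => rng (h x j))
    (fun j => measurable_rng.comp (hmj j)) hPm (by
      have : ∀ᵐ x ∂μ, ∀ j, x ∈ P → {x' ∈ P | rng (h x' j) = rng (h x j)}.Finite :=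
        ae_all_iff.2 fun j => ae_finite_rng_fibre μ (hmj j) hPm fun x hx => (hP x hx).1 j
      filter_upwards [this, hPe] with x hx hxP
      exact ⟨hxP, fun j => hx j hxP⟩)
  have hYm : ∀ n, MeasurableSet (disjointed D n) := fun n => MeasurableSet.disjointed hDm n
  have hYD : ∀ n, disjointed D n ⊆ D n := fun n => disjointed_subset D n
  have hsrc : ∀ n, ∀ x ∈ disjointed D n, ∀ j, src (h x j) = x := fun n x hx =>
    (hP x (hDP n (hYD n hx))).1
  refine ⟨disjointed D, fun n j =>
    { carrier := (fun x => h x j) '' disjointed D n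
      measurableSet := (hYm n).image_of_measurable_injOn (hmj j) fun x hx y hy e =>
        hDi n j (hYD n hx) (hYD n hy) (congrArg rng e)
      injOn_src := ?_
      injOn_rng := ?_ }, hYm, disjoint_disjointed D, ?_, ?_, ?_⟩
  · rintro _ ⟨x, hx, rfl⟩ _ ⟨y, hy, rfl⟩ e
    simp only [hsrc n x hx, hsrc n y hy] at e
    rw [Subtype.ext e]
  · rintro _ ⟨x, hx, rfl⟩ _ ⟨y, hy, rfl⟩ e
    rw [hDi n j (hYD n hx) (hYD n hy) e]
  · simpa only [iUnion_disjointed] using hDc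
  · intro n j
    rw [image_image]
    exact image_congr fun x hx => hsrc n x hx j
  · intro n i j hij
    rw [Set.disjoint_left]
    rintro _ ⟨x, hx, rfl⟩ ⟨y, hy, e⟩
    have hxy : x = y := Subtype.ext (by
      rw [← hsrc n x hx i, ← hsrc n y hy j]
      exact congrArg src e.symm)
    subst hxy
    exact (hP x (hDP n (hYD n hx))).2 i j hij e.symm

end Bisections

/-! ### Traces and relations of partial isometries -/

section PartialIsometries

variable {G : Type*} [MeasurableSpace G] [SetGroupoid G] [DiscreteMeasurableGroupoid G]

namespace Bisection

theorem ext_carrier {B C : Bisection G} (h : B.carrier = C.carrier) : B = C := by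
  cases B
  cases C
  simpa using h

/-- A Borel set of units as a bisection. -/
def ofUnits (Y : Set (unitSpace G)) (hY : MeasurableSet Y) : Bisection G where
  carrier := Subtype.val '' Y
  measurableSet := measurableSet_unitSpace.subtype_image hY
  injOn_src := (unit G).injOn_src.mono (by rintro _ ⟨x, -, rfl⟩; exact x.2)
  injOn_rng := (unit G).injOn_rng.mono (by rintro _ ⟨x, -, rfl⟩; exact x.2)

theorem rng_unit (x : unitSpace G) : rng (x : G) = x := by
  have h := rng_src (x : G)
  rwa [show src (x : G) = x from x.2] at h

theorem inv_unit (x : unitSpace G) : inv (x : G) = x := by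
  have hs : src (x : G) = x := x.2
  have h := inv_mul_self (x : G)
  have h2 : src (inv (x : G)) = x := by rw [src_inv, rng_unit]
  have h3 := mul_src_self (inv (x : G))
  rw [h2, h, hs] at h3
  exact h3.symm

/-- If `x⁻¹` and `y` lie in `B` and `xy` is defined, they have the same range and so coincide; only
the products `y⁻¹y` remain. This is the relation `s* s = p`. -/
theorem inverse_prod_self {B : Bisection G} {Y : Set (unitSpace G)} (hY : MeasurableSet Y)
    (h : src '' B.carrier = Subtype.val '' Y) : B.inverse.prod B = ofUnits Y hY := by
  refine ext_carrier ?_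
  change {z | ∃ x ∈ inv ⁻¹' B.carrier, ∃ y ∈ B.carrier, src x = rng y ∧ mul x y = z} = _ '' Y
  rw [← h]
  ext z
  constructor
  · rintro ⟨x, hx, y, hy, hxy, rfl⟩
    have e : inv x = y := B.injOn_rng hx hy (by rw [rng_inv, hxy])
    refine ⟨y, hy, ?_⟩
    rw [← e, src_inv, mul_inv_self]
  · rintro ⟨y, hy, rfl⟩
    exact ⟨inv y, by rwa [mem_preimage, inv_inv], y, hy, src_inv y, inv_mul_self y⟩

/-- A product `xy` that is a unit forces `y = x⁻¹`, an arrow in both `B` and `C`. This gives `τ(s*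
t) = 0` for disjoint bisections. -/
theorem inverse_prod_inter_unitSpace {B C : Bisection G} (h : Disjoint B.carrier C.carrier) :
    (B.inverse.prod C).carrier ∩ unitSpace G = ∅ := by
  refine eq_empty_of_forall_notMem ?_
  rintro _ ⟨⟨x, hx, y, hy, hxy, rfl⟩, hz⟩
  have h1 : mul x y = src y := (show src (mul x y) = mul x y from hz).symm.trans (src_mul _ _ hxy)
  have hyx : src (inv x) = rng (mul x y) := by rw [src_inv, rng_mul _ _ hxy]
  have h2 : mul (inv x) (mul x y) = y := inv_mul_cancel hxy
  have h3 : inv x = y := by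
    have h4 := rng_unit (G := G) ⟨mul x y, hz⟩
    have h5 := mul_src_self (inv x)
    rw [hyx] at h5
    rw [show rng (mul x y) = mul x y from h4] at h5
    rw [← h5, h2]
  exact Set.disjoint_left.1 h hx (h3 ▸ hy)

variable (μ : Measure (unitSpace G)) [IsFiniteMeasure μ]

/-- The arrow `b⁻¹x` is a unit exactly when `x = b`. -/
theorem translate_indicator_unitSpace (B : Bisection G) :
    translate B.carrier ((unitSpace G).indicator fun _ => 1) = B.carrier.indicator fun _ => 1 := by
  funext x
  by_cases hx : ∃ b ∈ B.carrier, rng b = rng x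
  · obtain ⟨b, hb, h⟩ := hx
    have hbx := (src_inv b).trans h
    rw [translate_of_mem B.injOn_rng _ hb h]
    by_cases hxB : x ∈ B.carrier
    · have e : b = x := B.injOn_rng hb hxB h
      subst e
      rw [inv_mul_self, indicator_of_mem (show src b ∈ unitSpace G from src_src b),
        indicator_of_mem hxB]
    · rw [indicator_of_notMem hxB, indicator_of_notMem]
      intro hu
      have h2 : mul (inv b) x = src b := by
        have h3 : rng (mul (inv b) x) = mul (inv b) x := rng_unit (G := G) ⟨_, hu⟩
        rw [rng_mul _ _ hbx, rng_inv] at h3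
        exact h3.symm
      have h4 := mul_inv_cancel h
      rw [h2, mul_src_self] at h4
      exact hxB (h4 ▸ hb)
  · rw [translate_of_forall_ne _ fun b hb h => hx ⟨b, hb, h⟩, indicator_of_notMem]
    exact fun hxB => hx ⟨x, hxB, rfl⟩

theorem trace_toOperator (B : Bisection G) :
    trace μ (B.toOperator μ) = ((arrowMeasure μ (B.carrier ∩ unitSpace G)).toReal : ℂ) := by
  have h : (B.toOperator μ (unitVector μ) : G → ℂ) =ᵐ[arrowMeasure μ]
      B.carrier.indicator fun _ => 1 := by
    rw [← translate_indicator_unitSpace]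
    exact (coeFn_toOperator μ B _).trans (B.translate_congr μ indicatorConstLp_coeFn)
  rw [trace]
  unfold unitVector at h ⊢
  rw [L2.inner_indicatorConstLp_one, setIntegral_congr_ae measurableSet_unitSpace
      (g := B.carrier.indicator fun _ => 1) (h.mono fun x hx _ => hx),
    setIntegral_indicator B.measurableSet, setIntegral_const, inter_comm]
  simp [Measure.real]

theorem arrowMeasure_units {Y : Set (unitSpace G)} (hY : MeasurableSet Y) :
    arrowMeasure μ (Subtype.val '' Y) = μ Y := by
  rw [arrowMeasure_apply μ (measurableSet_unitSpace.subtype_image hY), ← lintegral_indicator_one hY]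
  congr 1
  funext x
  by_cases hx : x ∈ Y
  · have e : src ⁻¹' {(x : G)} ∩ Subtype.val '' Y = {(x : G)} := by
      ext g
      constructor
      · rintro ⟨h1, y, hy, rfl⟩
        exact (show src (y : G) = y from y.2).symm.trans h1
      · rintro rfl
        exact ⟨x.2, x, hx, rfl⟩
    rw [e]
    simp [hx]
  · have e : src ⁻¹' {(x : G)} ∩ Subtype.val '' Y = ∅ := by
      refine eq_empty_of_forall_notMem ?_
      rintro _ ⟨h1, y, hy, rfl⟩
      have : y = x := Subtype.ext ((show src (y : G) = y from y.2).symm.trans h1)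
      exact hx (this ▸ hy)
    rw [e]
    simp [hx]

theorem trace_ofUnits {Y : Set (unitSpace G)} (hY : MeasurableSet Y) :
    trace μ ((ofUnits Y hY).toOperator μ) = ((μ Y).toReal : ℂ) := by
  rw [trace_toOperator]
  have e : (ofUnits Y hY).carrier ∩ unitSpace G = Subtype.val '' Y :=
    inter_eq_left.2 (by rintro _ ⟨x, -, rfl⟩; exact x.2)
  rw [e, arrowMeasure_units μ hY]

/-- For a set `W` of units, the operator is multiplication by the indicator of the arrows with range
in `W`. -/
theorem toOperator_ofUnits_union {Y Z : Set (unitSpace G)} (hY : MeasurableSet Y)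
    (hZ : MeasurableSet Z) (h : Disjoint Y Z) :
    (ofUnits (Y ∪ Z) (hY.union hZ)).toOperator μ =
      (ofUnits Y hY).toOperator μ + (ofUnits Z hZ).toOperator μ := by
  have key : ∀ (W : Set (unitSpace G)) (hW : MeasurableSet W) (ξ : G → ℂ) (x : G),
      translate (ofUnits W hW).carrier ξ x =
        W.indicator (fun _ => ξ x) ⟨rng x, src_rng x⟩ := by
    intro W hW ξ x
    by_cases hx : (⟨rng x, src_rng x⟩ : unitSpace G) ∈ W
    · have hm : rng x ∈ (ofUnits W hW).carrier := ⟨_, hx, rfl⟩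
      rw [translate_of_mem (ofUnits W hW).injOn_rng _ hm (rng_rng x), indicator_of_mem hx,
        show inv (rng x) = rng x from inv_unit (G := G) ⟨_, src_rng x⟩, rng_mul_self]
    · rw [indicator_of_notMem hx, translate_of_forall_ne]
      rintro _ ⟨y, hy, rfl⟩ e
      rw [rng_unit] at e
      exact hx ((Subtype.ext e : y = ⟨rng x, src_rng x⟩) ▸ hy)
  ext1 ξ
  refine Lp.ext ?_
  rw [_root_.add_apply]
  filter_upwards [coeFn_toOperator μ (ofUnits (Y ∪ Z) (hY.union hZ)) ξ,
    coeFn_toOperator μ (ofUnits Y hY) ξ, coeFn_toOperator μ (ofUnits Z hZ) ξ,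
    Lp.coeFn_add ((ofUnits Y hY).toOperator μ ξ) ((ofUnits Z hZ).toOperator μ ξ)] with x h1 h2 h3 h4
  rw [h4, Pi.add_apply, h1, h2, h3, key, key, key, indicator_union_of_disjoint h]

theorem measurableSet_accumulate {Y : ℕ → Set (unitSpace G)} (hY : ∀ n, MeasurableSet (Y n))
    (K : ℕ) : MeasurableSet (accumulate Y K) := by
  rw [accumulate_def]
  exact MeasurableSet.iUnion fun n => MeasurableSet.iUnion fun _ => hY n

/-- Since models are linear, this additive relation passes to them without error. `accumulate Y K`
includes the index `K`, hence the range up to `K + 1`. -/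
theorem toOperator_ofUnits_accumulate {Y : ℕ → Set (unitSpace G)} (hY : ∀ n, MeasurableSet (Y n))
    (hd : Pairwise (Function.onFun Disjoint Y)) (K : ℕ) :
    (ofUnits (accumulate Y K) (measurableSet_accumulate hY K)).toOperator μ =
      ∑ n ∈ Finset.range (K + 1), (ofUnits (Y n) (hY n)).toOperator μ := by
  induction K with
  | zero =>
    rw [zero_add, Finset.sum_range_one]
    congr 2
    simp [accumulate_zero_nat]
  | succ K ih =>
    have hdis : Disjoint (accumulate Y K) (Y (K + 1)) := by
      rw [accumulate_def, disjoint_iUnion₂_left]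
      exact fun n hn => hd (by omega)
    rw [Finset.sum_range_succ, ← ih, ← toOperator_ofUnits_union μ (measurableSet_accumulate hY K) (hY _) hdis]
    congr 2
    exact accumulate_succ Y K

end Bisection

end PartialIsometries

/-! ### Partial permutation matrices -/

section PartialPermMatrices

open scoped Matrix

theorem mem_partialPermMatrices_iff {d : ℕ} {M : Matrix (Fin d) (Fin d) ℂ} :
    M ∈ partialPermMatrices d ↔ (∀ i j, M i j = 0 ∨ M i j = 1) ∧
      (∀ i j j', M i j ≠ 0 → M i j' ≠ 0 → j = j') ∧
      ∀ i i' j, M i j ≠ 0 → M i' j ≠ 0 → i = i' := by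
  classical
  constructor
  · rintro ⟨σ, rfl⟩
    simp only [PEquiv.toMatrix_apply]
    refine ⟨fun i j => ?_, fun i j j' h h' => ?_, fun i i' j h h' => ?_⟩
    · split_ifs <;> simp
    · have h1 : j ∈ σ i := by simpa using h
      have h2 : j' ∈ σ i := by simpa using h'
      exact Option.mem_unique h1 h2
    · have h1 : j ∈ σ i := by simpa using h
      have h2 : j ∈ σ i' := by simpa using h'
      exact σ.inj h1 h2
  · rintro ⟨h01, hr, hc⟩
    refine ⟨⟨fun i => if h : ∃ j, M i j ≠ 0 then some h.choose else none,
      fun j => if h : ∃ i, M i j ≠ 0 then some h.choose else none, fun i j => ?_⟩, ?_⟩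
    · simp only [Option.dite_none_right_eq_some, Option.some.injEq]
      constructor
      · rintro ⟨h, rfl⟩
        have hex : ∃ j', M h.choose j' ≠ 0 := ⟨_, h.choose_spec⟩
        exact ⟨hex, hr _ _ _ hex.choose_spec h.choose_spec⟩
      · rintro ⟨h, rfl⟩
        have hex : ∃ i', M i' h.choose ≠ 0 := ⟨_, h.choose_spec⟩
        exact ⟨hex, hc _ _ _ hex.choose_spec h.choose_spec⟩
    · ext i j
      simp only [PEquiv.toMatrix_apply, PEquiv.coe_mk, Option.mem_def,
        Option.dite_none_right_eq_some, Option.some.injEq]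
      by_cases hij : M i j = 0
      · rw [hij, if_neg]
        rintro ⟨h, rfl⟩
        exact h.choose_spec hij
      · rw [(h01 i j).resolve_left hij, if_pos]
        have hex : ∃ j', M i j' ≠ 0 := ⟨j, hij⟩
        exact ⟨hex, hr _ _ _ hex.choose_spec hij⟩

theorem mul_mem_partialPermMatrices {d : ℕ} {M N : Matrix (Fin d) (Fin d) ℂ}
    (hM : M ∈ partialPermMatrices d) (hN : N ∈ partialPermMatrices d) :
    M * N ∈ partialPermMatrices d := by
  obtain ⟨σ, rfl⟩ := hM
  obtain ⟨ρ, rfl⟩ := hN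
  exact ⟨σ.trans ρ, PEquiv.toMatrix_trans σ ρ⟩

theorem submatrix_mem_partialPermMatrices {d : ℕ} {M : Matrix (Fin d) (Fin d) ℂ}
    (hM : M ∈ partialPermMatrices d) (P : Equiv.Perm (Fin d)) :
    M.submatrix P P ∈ partialPermMatrices d := by
  rw [mem_partialPermMatrices_iff] at hM ⊢
  exact ⟨fun i j => hM.1 _ _, fun i j j' h h' => P.injective (hM.2.1 _ _ _ h h'),
    fun i i' j h h' => P.injective (hM.2.2 _ _ _ h h')⟩

theorem trace_conjTranspose_mul_self {n : Type*} [Fintype n] (M : Matrix n n ℂ) :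
    (Mᴴ * M).trace = ((∑ i, ∑ j, ‖M i j‖ ^ 2 : ℝ) : ℂ) := by
  rw [Finset.sum_comm]
  simp only [Matrix.trace, Matrix.diag_apply, Matrix.mul_apply, Matrix.conjTranspose_apply]
  push_cast
  refine Finset.sum_congr rfl fun i _ => Finset.sum_congr rfl fun j _ => ?_
  rw [← Complex.conj_mul']
  rfl

theorem normTwo_eq {d : ℕ} (M : Matrix (Fin d) (Fin d) ℂ) :
    normTwo M = Real.sqrt ((∑ i, ∑ j, ‖M i j‖ ^ 2) / d) := by
  rw [normTwo, normTrace, trace_conjTranspose_mul_self]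
  congr 1
  rw [← Complex.ofReal_natCast, ← Complex.ofReal_div, Complex.ofReal_re]

/-- The diagonal is part of the Hilbert–Schmidt sum. The bound `δ ^ 2` is weakened to `δ` so that
all errors in the counting are linear in `δ`. -/
theorem sum_norm_diag_sq_le {d : ℕ} {M : Matrix (Fin d) (Fin d) ℂ} {δ : ℝ} (hd : 1 ≤ d)
    (hδ : δ ≤ 1) (h : normTwo M < δ) : ∑ v, ‖M v v‖ ^ 2 ≤ δ * d := by
  have hd' : (0 : ℝ) < d := by exact_mod_cast hd
  have h0 : 0 < δ := (Real.sqrt_nonneg _).trans_lt h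
  rw [normTwo_eq, Real.sqrt_lt' h0, div_lt_iff₀ hd'] at h
  have h1 : ∑ v, ‖M v v‖ ^ 2 ≤ ∑ i, ∑ j, ‖M i j‖ ^ 2 := Finset.sum_le_sum fun i _ =>
    Finset.single_le_sum (f := fun j => ‖M i j‖ ^ 2) (fun j _ => sq_nonneg _) (Finset.mem_univ i)
  have h2 : δ ^ 2 * d ≤ δ * d :=
    mul_le_mul_of_nonneg_right (by nlinarith) hd'.le
  linarith

/-- Diagonal entries are `0` or `1`, so there is no cancellation in the trace. -/
theorem sum_norm_diag_le {d : ℕ} {M : Matrix (Fin d) (Fin d) ℂ} {δ : ℝ} (hd : 1 ≤ d)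
    (hM : M ∈ partialPermMatrices d) (h : ‖normTrace M‖ < δ) : ∑ v, ‖M v v‖ ≤ δ * d := by
  have hd' : (0 : ℝ) < d := by exact_mod_cast hd
  have e : M.trace = ((∑ v, ‖M v v‖ : ℝ) : ℂ) := by
    rw [Matrix.trace, Complex.ofReal_sum]
    refine Finset.sum_congr rfl fun v _ => ?_
    rcases (mem_partialPermMatrices_iff.1 hM).1 v v with h | h <;> simp [h]
  rw [normTrace, norm_div, Complex.norm_natCast, div_lt_iff₀ hd', e, Complex.norm_real] at h
  exact (le_abs_self _).trans h.le

end PartialPermMatrices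

/-! ### Conjugates of a family of partial permutation matrices -/

section Counting

open Classical in
/-- In a family of partial permutation matrices `a`, suppose that all but `k` points have at least
`m` images. Then a tuple of matrices is conjugate to `a` by few permutations. -/
theorem card_conj_fibre_le {S : Type*} {d m k : ℕ} (hd : 1 ≤ d) (hm : 1 ≤ m)
    {a : S → Matrix (Fin d) (Fin d) ℂ} (ha : ∀ s, a s ∈ partialPermMatrices d)
    (hbad : (Finset.univ.filter fun v : Fin d => ¬ ∃ w : Fin m → Fin d, Function.Injective w ∧
      ∀ j, ∃ s, a s (w j) v ≠ 0).card ≤ k) (x : S → Matrix (Fin d) (Fin d) ℂ) :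
    (Finset.univ.filter fun P : Equiv.Perm (Fin d) =>
      (fun s => (a s).submatrix P.symm P.symm) = x).card ≤ d ^ (d / m + k) := by
  -- The classes of `R` are the connected components of the graph with an edge from `v` to each of
  -- its images.
  let R : Setoid (Fin d) := Relation.EqvGen.setoid fun v w => ∃ s, a s w v ≠ 0
  have hQ : Fintype.card (Quotient R) ≤ d / m + k := by
    let good : Fin d → Prop := fun v => ∃ w : Fin m → Fin d, Function.Injective w ∧
      ∀ j, ∃ s, a s (w j) v ≠ 0
    let Qg : Finset (Quotient R) := Finset.univ.filter fun q => ∃ v, good v ∧ ⟦v⟧ = q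
    -- A component with a good point contains its `m` images; any other component has a bad
    -- representative, and these number at most `k`.
    have h1 : Qg.card ≤ d / m := by
      rw [Nat.le_div_iff_mul_le hm]
      have h2 : ∀ q ∈ Qg, m ≤ (Finset.univ.filter fun v : Fin d => ⟦v⟧ = q).card := by
        intro q hq
        obtain ⟨v, ⟨w, hw, hws⟩, rfl⟩ := (Finset.mem_filter.1 hq).2
        have h3 : Finset.univ.image w ⊆
            Finset.univ.filter fun u : Fin d => (⟦u⟧ : Quotient R) = ⟦v⟧ := by
          intro u hu
          obtain ⟨j, -, rfl⟩ := Finset.mem_image.1 hu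
          exact Finset.mem_filter.2 ⟨Finset.mem_univ _, Quotient.sound
            (Setoid.symm (Relation.EqvGen.rel _ _ (hws j)))⟩
        have h4 := Finset.card_le_card h3
        rwa [Finset.card_image_of_injective _ hw, Finset.card_univ, Fintype.card_fin] at h4
      have h5 := Finset.card_eq_sum_card_fiberwise (f := fun v : Fin d => (⟦v⟧ : Quotient R))
        (s := Finset.univ) (t := Finset.univ) (fun _ _ => Finset.mem_coe.2 (Finset.mem_univ _))
      rw [Finset.card_univ, Fintype.card_fin] at h5
      calc Qg.card * m = ∑ q ∈ Qg, m := by simp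
        _ ≤ ∑ q ∈ Qg, (Finset.univ.filter fun v : Fin d => ⟦v⟧ = q).card := Finset.sum_le_sum h2
        _ ≤ ∑ q, (Finset.univ.filter fun v : Fin d => ⟦v⟧ = q).card :=
          Finset.sum_le_univ_sum_of_nonneg fun _ => Nat.zero_le _
        _ = d := h5.symm
    have h2 : (Finset.univ \ Qg).card ≤ k := by
      refine le_trans (Finset.card_le_card_of_injOn Quotient.out ?_ Quotient.out_injective.injOn) hbad
      intro q hq
      have hq' := (Finset.mem_sdiff.1 (Finset.mem_coe.1 hq)).2
      refine Finset.mem_coe.2 (Finset.mem_filter.2 ⟨Finset.mem_univ _, fun hg => hq' ?_⟩)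
      exact Finset.mem_filter.2 ⟨Finset.mem_univ _, _, hg, Quotient.out_eq q⟩
    have h3 := Finset.card_sdiff_add_card_eq_card (Finset.subset_univ Qg)
    rw [Finset.card_univ] at h3
    omega
  have hinj : InjOn (fun (P : Equiv.Perm (Fin d)) (q : Quotient R) => P q.out)
      (Finset.univ.filter fun P : Equiv.Perm (Fin d) =>
        (fun s => (a s).submatrix P.symm P.symm) = x : Finset (Equiv.Perm (Fin d))) := by
    intro P hP P' hP' h
    have hP := congrFun (Finset.mem_filter.1 (Finset.mem_coe.1 hP)).2
    have hP' := congrFun (Finset.mem_filter.1 (Finset.mem_coe.1 hP')).2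
    have hx : ∀ s, x s ∈ partialPermMatrices d := fun s => by
      rw [← hP s]
      exact submatrix_mem_partialPermMatrices (ha s) _
    have hxP : ∀ s w v, x s (P w) (P v) = a s w v := fun s w v => by simp [← hP s]
    have hxP' : ∀ s w v, x s (P' w) (P' v) = a s w v := fun s w v => by simp [← hP' s]
    -- Both permutations carry edges of `a` to edges of `x`, and `x s` is a partial injection, so
    -- agreement propagates along edges in both directions.
    have key : ∀ v w, Relation.EqvGen (fun v w => ∃ s, a s w v ≠ 0) v w →
        (P v = P' v ↔ P w = P' w) := by
      intro v w hvw
      induction hvw with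
      | rel v w h =>
        obtain ⟨s, hs⟩ := h
        obtain ⟨-, h1, h2⟩ := mem_partialPermMatrices_iff.1 (hx s)
        constructor
        · intro e
          refine h2 _ _ (P v) (by rwa [hxP]) ?_
          rwa [e, hxP']
        · intro e
          refine h1 (P w) _ _ (by rwa [hxP]) ?_
          rwa [e, hxP']
      | refl v => exact Iff.rfl
      | symm v w _ ih => exact ih.symm
      | trans u v w _ _ ih ih' => exact ih.trans ih'
    ext1 v
    exact (key _ _ (Quotient.mk_out (s := R) v)).1 (congrFun h ⟦v⟧)
  calc _ ≤ (Finset.univ : Finset (Quotient R → Fin d)).card :=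
        Finset.card_le_card_of_injOn _ (fun _ _ => Finset.mem_coe.2 (Finset.mem_univ _)) hinj
    _ = d ^ Fintype.card (Quotient R) := by simp
    _ ≤ d ^ (d / m + k) := Nat.pow_le_pow_right hd hQ

open Classical in
/-- In a family of partial permutation matrices `a`, suppose that all but `k` points have at least
`m` images. Then `a` has many conjugates by permutations. -/
theorem factorial_le_card_conj {S : Type*} {d m k : ℕ} (hd : 1 ≤ d) (hm : 1 ≤ m)
    {a : S → Matrix (Fin d) (Fin d) ℂ} (ha : ∀ s, a s ∈ partialPermMatrices d)
    (hbad : (Finset.univ.filter fun v : Fin d => ¬ ∃ w : Fin m → Fin d, Function.Injective w ∧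
      ∀ j, ∃ s, a s (w j) v ≠ 0).card ≤ k) :
    d.factorial ≤ d ^ (d / m + k) * (Finset.univ.image fun (P : Equiv.Perm (Fin d)) (s : S) =>
      (a s).submatrix P.symm P.symm).card := by
  have h := Finset.card_le_mul_card_image (f := fun (P : Equiv.Perm (Fin d)) (s : S) =>
      (a s).submatrix P.symm P.symm) Finset.univ (d ^ (d / m + k))
      (fun x _ => card_conj_fibre_le hd hm ha hbad x)
  rwa [Finset.card_univ, Fintype.card_perm, Fintype.card_fin] at h

end Counting

/-! ### Points with many images in a finite model -/

section Model

theorem eq_of_norm_sub_sq_lt_one {u v : ℂ} (hu : u = 0 ∨ u = 1) (hv : v = 0 ∨ v = 1)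
    (h : ‖u - v‖ ^ 2 < 1) : u = v := by
  rcases hu with rfl | rfl <;> rcases hv with rfl | rfl <;> simp at h ⊢

open Classical in
/-- Most points of an approximate model of a family of disjoint bisections `a t j`, `j : Fin m`,
with source projections `p t`, have at least `m` images. -/
theorem card_few_images_le {κ : Type*} [Fintype κ] {d m : ℕ} {ε δ : ℝ} (hd : 1 ≤ d) (hδ : δ ≤ 1)
    {y : Matrix (Fin d) (Fin d) ℂ} {p : κ → Matrix (Fin d) (Fin d) ℂ}
    {a b : κ → Fin m → Matrix (Fin d) (Fin d) ℂ} {e : κ → Fin m → Fin m → Matrix (Fin d) (Fin d) ℂ}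
    (hy : y ∈ partialPermMatrices d) (hp : ∀ t, p t ∈ partialPermMatrices d)
    (ha : ∀ t j, a t j ∈ partialPermMatrices d) (hb : ∀ t j, b t j ∈ partialPermMatrices d)
    (he : ∀ t i j, e t i j ∈ partialPermMatrices d)
    (hsum : y = ∑ t, p t) (htr : 1 - ε ≤ (normTrace y).re)
    (h1 : ∀ t j, normTwo (p t - b t j * a t j) < δ)
    (h2 : ∀ t i j, normTwo (e t i j - b t i * a t j) < δ)
    (h3 : ∀ t i j, i ≠ j → ‖normTrace (e t i j)‖ < δ) :
    ((Finset.univ.filter fun v : Fin d => ¬ ∃ w : Fin m → Fin d, Function.Injective w ∧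
      ∀ j, ∃ s : κ × Fin m, a s.1 s.2 (w j) v ≠ 0).card : ℝ) ≤
      (ε + Fintype.card κ * (m * δ + m * (m * (2 * δ)))) * d := by
  have hd' : (0 : ℝ) < d := by exact_mod_cast hd
  have h01 : ∀ {M : Matrix (Fin d) (Fin d) ℂ}, M ∈ partialPermMatrices d → ∀ i j,
      M i j = 0 ∨ M i j = 1 := fun hM => (mem_partialPermMatrices_iff.1 hM).1
  have hba : ∀ t i j, b t i * a t j ∈ partialPermMatrices d := fun t i j =>
    mul_mem_partialPermMatrices (hb t i) (ha t j)
  -- Markov's inequality for the total defect `f`: the diagonal entries involved are `0` or `1`, so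
  -- `f v < 1` makes each needed relation exact at `v`. Thus `f ≥ 1` at every bad point, and the bad
  -- points number at most `∑ v, f v`.
  let f₁ : κ → Fin m → Fin d → ℝ := fun t j v => ‖(p t - b t j * a t j) v v‖ ^ 2
  let f₂ : κ → Fin m → Fin m → Fin d → ℝ := fun t i j v =>
    if i = j then 0 else ‖(e t i j - b t i * a t j) v v‖ ^ 2 + ‖e t i j v v‖
  let f : Fin d → ℝ := fun v => (1 - (y v v).re) + ∑ t, (∑ j, f₁ t j v + ∑ i, ∑ j, f₂ t i j v)
  have hf₁ : ∀ t j v, 0 ≤ f₁ t j v := fun t j v => sq_nonneg _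
  have hf₂ : ∀ t i j v, 0 ≤ f₂ t i j v := fun t i j v => by
    simp only [f₂]
    split_ifs
    · exact le_rfl
    · positivity
  have hs₁ : ∀ t v, 0 ≤ ∑ j, f₁ t j v := fun t v => Finset.sum_nonneg fun j _ => hf₁ t j v
  have hs₂ : ∀ t i v, 0 ≤ ∑ j, f₂ t i j v := fun t i v => Finset.sum_nonneg fun j _ => hf₂ t i j v
  have hs₃ : ∀ t v, 0 ≤ ∑ i, ∑ j, f₂ t i j v := fun t v => Finset.sum_nonneg fun i _ => hs₂ t i v
  have hs₄ : ∀ v, 0 ≤ ∑ t, (∑ j, f₁ t j v + ∑ i, ∑ j, f₂ t i j v) := fun v =>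
    Finset.sum_nonneg fun t _ => add_nonneg (hs₁ t v) (hs₃ t v)
  have hy0 : ∀ v, 0 ≤ 1 - (y v v).re := fun v => by rcases h01 hy v v with h | h <;> simp [h]
  have hf0 : ∀ v, 0 ≤ f v := fun v => add_nonneg (hy0 v) (hs₄ v)
  have hf1 : ∀ v, (¬ ∃ w : Fin m → Fin d, Function.Injective w ∧
      ∀ j, ∃ s : κ × Fin m, a s.1 s.2 (w j) v ≠ 0) → 1 ≤ f v := by
    intro v hv
    by_contra! hlt
    have hyv : y v v ≠ 0 := by
      intro h0
      have := hs₄ v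
      simp only [f, h0, Complex.zero_re, sub_zero] at hlt
      linarith
    rw [hsum, Matrix.sum_apply] at hyv
    obtain ⟨t, -, ht⟩ := Finset.exists_ne_zero_of_sum_ne_zero hyv
    have hlt' : ∑ j, f₁ t j v + ∑ i, ∑ j, f₂ t i j v < 1 := by
      have := Finset.single_le_sum (f := fun t => ∑ j, f₁ t j v + ∑ i, ∑ j, f₂ t i j v)
        (fun t _ => add_nonneg (hs₁ t v) (hs₃ t v)) (Finset.mem_univ t)
      have := hy0 v
      simp only [f] at hlt
      linarith
    have hba1 : ∀ j, (b t j * a t j) v v ≠ 0 := by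
      intro j
      have h4 := Finset.single_le_sum (f := fun j => f₁ t j v) (fun j _ => hf₁ t j v)
        (Finset.mem_univ j)
      have h5 : f₁ t j v < 1 := by
        have := hs₃ t v
        linarith
      rwa [← eq_of_norm_sub_sq_lt_one (h01 (hp t) v v) (h01 (hba t j j) v v) h5]
    -- A nonzero diagonal entry of `b t j * a t j` is a path from `v` to an image `w` and back.
    have hex : ∀ j, ∃ w, b t j v w ≠ 0 ∧ a t j w v ≠ 0 := by
      intro j
      have h4 := hba1 j
      rw [Matrix.mul_apply] at h4
      obtain ⟨w, -, hw⟩ := Finset.exists_ne_zero_of_sum_ne_zero h4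
      exact ⟨w, left_ne_zero_of_mul hw, right_ne_zero_of_mul hw⟩
    choose w hwb hwa using hex
    refine hv ⟨w, fun i j hij => ?_, fun j => ⟨(t, j), hwa j⟩⟩
    by_contra hne
    have h4 := Finset.single_le_sum (f := fun j => f₂ t i j v) (fun j _ => hf₂ t i j v)
      (Finset.mem_univ j)
    have h5 := Finset.single_le_sum (f := fun i => ∑ j, f₂ t i j v) (fun i _ => hs₂ t i v)
      (Finset.mem_univ i)
    have h6 : ‖(e t i j - b t i * a t j) v v‖ ^ 2 + ‖e t i j v v‖ < 1 := by
      have := hs₁ t v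
      simp only [f₂, if_neg hne] at h4 h5 hlt'
      linarith
    have h7 := eq_of_norm_sub_sq_lt_one (h01 (he t i j) v v) (h01 (hba t i j) v v)
      (lt_of_le_of_lt (le_add_of_nonneg_right (norm_nonneg _)) h6)
    have h8 : e t i j v v = 0 := by
      rcases h01 (he t i j) v v with h | h
      · exact h
      · rw [h, norm_one] at h6
        have := sq_nonneg ‖(e t i j - b t i * a t j) v v‖
        linarith
    -- If `w i = w j`, then going out by `a t j` and back by `b t i` returns to `v`. Row `v` of `b t
    -- i` has a single nonzero entry, so this is the only term, and it contradicts the vanishing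
    -- diagonal entry.
    rw [h8, Matrix.mul_apply, Finset.sum_eq_single (w i)] at h7
    · exact mul_ne_zero (hwb i) (hij ▸ hwa j) h7.symm
    · intro u _ hu
      by_contra h9
      exact hu ((mem_partialPermMatrices_iff.1 (hb t i)).2.1 _ _ _ (left_ne_zero_of_mul h9) (hwb i))
    · exact fun h => absurd (Finset.mem_univ _) h
  have hδ0 : ∀ t : κ, ∀ j : Fin m, 0 < δ := fun t j => (Real.sqrt_nonneg _).trans_lt (h1 t j)
  calc _ = ∑ v ∈ Finset.univ.filter fun v : Fin d => ¬ ∃ w : Fin m → Fin d,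
          Function.Injective w ∧ ∀ j, ∃ s : κ × Fin m, a s.1 s.2 (w j) v ≠ 0, (1 : ℝ) := by simp
    _ ≤ ∑ v ∈ Finset.univ.filter fun v : Fin d => ¬ ∃ w : Fin m → Fin d,
          Function.Injective w ∧ ∀ j, ∃ s : κ × Fin m, a s.1 s.2 (w j) v ≠ 0, f v :=
        Finset.sum_le_sum fun v hv => hf1 v (Finset.mem_filter.1 hv).2
    _ ≤ ∑ v, f v := Finset.sum_le_univ_sum_of_nonneg hf0
    _ = ∑ v, (1 - (y v v).re) + ∑ t, (∑ j, ∑ v, f₁ t j v + ∑ i, ∑ j, ∑ v, f₂ t i j v) := by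
        simp only [f, Finset.sum_add_distrib]
        congr 1
        rw [Finset.sum_comm, Finset.sum_comm (s := Finset.univ (α := Fin d))]
        congr 1
        · exact Finset.sum_congr rfl fun t _ => Finset.sum_comm
        · refine Finset.sum_congr rfl fun t _ => ?_
          rw [Finset.sum_comm]
          exact Finset.sum_congr rfl fun i _ => Finset.sum_comm
    _ ≤ ε * d + ∑ _t : κ, (∑ _j : Fin m, δ * d + ∑ _i : Fin m, ∑ _j : Fin m, 2 * δ * d) := by
        refine add_le_add ?_ (Finset.sum_le_sum fun t _ => add_le_add
          (Finset.sum_le_sum fun j _ => sum_norm_diag_sq_le hd hδ (h1 t j))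
          (Finset.sum_le_sum fun i _ => Finset.sum_le_sum fun j _ => ?_))
        · have e1 : (normTrace y).re = (∑ v, (y v v).re) / d := by
            rw [normTrace, Matrix.trace, Complex.div_natCast_re, Complex.re_sum]
            rfl
          rw [e1, le_div_iff₀ hd'] at htr
          simp only [Finset.sum_sub_distrib, Finset.sum_const, Finset.card_univ, Fintype.card_fin,
            nsmul_eq_mul, mul_one]
          linarith
        · simp only [f₂]
          split_ifs with hij
          · have := hδ0 t i
            simp only [Finset.sum_const_zero]
            positivity
          · rw [Finset.sum_add_distrib]
            have h4 := sum_norm_diag_sq_le hd hδ (h2 t i j)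
            have h5 := sum_norm_diag_le hd (he t i j) (h3 t i j hij)
            linarith
    _ = (ε + Fintype.card κ * (m * δ + m * (m * (2 * δ)))) * d := by
        simp only [Finset.sum_const, Finset.card_univ, Fintype.card_fin, nsmul_eq_mul]
        ring

end Model

/-! ### Amplifications and conjugates of approximate models -/

section Amplification

open scoped Matrix

theorem norm_normTrace_le_one {d : ℕ} {M : Matrix (Fin d) (Fin d) ℂ}
    (hM : M ∈ partialPermMatrices d) : ‖normTrace M‖ ≤ 1 := by
  rw [normTrace, norm_div, Complex.norm_natCast]
  refine div_le_one_of_le₀ ?_ (Nat.cast_nonneg d)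
  refine (norm_sum_le _ _).trans ?_
  refine (Finset.sum_le_card_nsmul _ _ 1 fun v _ => ?_).trans (by simp)
  rw [Matrix.diag_apply]
  rcases (mem_partialPermMatrices_iff.1 hM).1 v v with h | h <;> simp [h]

/-- The block diagonal matrix with `q` blocks `M` and a zero block of size `r`. -/
def amplify {d₀ q r d : ℕ} (ι : (Fin d₀ × Fin q) ⊕ Fin r ≃ Fin d) :
    Matrix (Fin d₀) (Fin d₀) ℂ →ₗ[ℂ] Matrix (Fin d) (Fin d) ℂ where
  toFun M := Matrix.reindex ι ι (Matrix.fromBlocks (Matrix.blockDiagonal fun _ => M) 0 0 0)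
  map_add' M N := by
    ext i j
    generalize hi : ι.symm i = i'
    generalize hj : ι.symm j = j'
    rcases i' with ⟨i₁, i₂⟩ | i' <;> rcases j' with ⟨j₁, j₂⟩ | j' <;>
      simp [hi, hj, Matrix.blockDiagonal_apply]
    split_ifs <;> simp
  map_smul' c M := by
    ext i j
    generalize hi : ι.symm i = i'
    generalize hj : ι.symm j = j'
    rcases i' with ⟨i₁, i₂⟩ | i' <;> rcases j' with ⟨j₁, j₂⟩ | j' <;>
      simp [hi, hj, Matrix.blockDiagonal_apply]

variable {d₀ q r d : ℕ} (ι : (Fin d₀ × Fin q) ⊕ Fin r ≃ Fin d)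

theorem amplify_mul (M N : Matrix (Fin d₀) (Fin d₀) ℂ) :
    amplify ι (M * N) = amplify ι M * amplify ι N := by
  simp only [amplify, LinearMap.coe_mk, AddHom.coe_mk, Matrix.reindex_apply,
    Matrix.submatrix_mul_equiv, Matrix.fromBlocks_multiply, Matrix.blockDiagonal_mul, Matrix.mul_zero,
    Matrix.zero_mul, add_zero]

theorem amplify_conjTranspose (M : Matrix (Fin d₀) (Fin d₀) ℂ) :
    amplify ι Mᴴ = (amplify ι M)ᴴ := by
  simp only [amplify, LinearMap.coe_mk, AddHom.coe_mk, Matrix.reindex_apply,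
    Matrix.conjTranspose_submatrix, Matrix.fromBlocks_conjTranspose,
    Matrix.blockDiagonal_conjTranspose, Matrix.conjTranspose_zero]

theorem trace_amplify (M : Matrix (Fin d₀) (Fin d₀) ℂ) : (amplify ι M).trace = q * M.trace := by
  have e : (amplify ι M).trace =
      (Matrix.fromBlocks (Matrix.blockDiagonal fun _ : Fin q => M) 0 0 0).trace (n := _ ⊕ Fin r) :=
    ι.symm.sum_comp fun i => Matrix.fromBlocks (Matrix.blockDiagonal fun _ : Fin q => M) 0 0 0 i i
  rw [e, Matrix.trace, Fintype.sum_sum_type]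
  simpa [Matrix.trace] using Matrix.trace_blockDiagonal fun _ : Fin q => M

theorem amplify_mem {M : Matrix (Fin d₀) (Fin d₀) ℂ} (hM : M ∈ partialPermMatrices d₀) :
    amplify ι M ∈ partialPermMatrices d := by
  rw [mem_partialPermMatrices_iff] at hM ⊢
  have hap : ∀ i j, amplify ι M i j =
      Matrix.fromBlocks (Matrix.blockDiagonal fun _ => M) 0 0 0 (ι.symm i) (ι.symm j) := fun _ _ => rfl
  obtain ⟨h1, h2, h3⟩ := hM
  refine ⟨fun i j => ?_, fun i j j' h h' => ι.symm.injective ?_,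
    fun i i' j h h' => ι.symm.injective ?_⟩
  · rw [hap]
    rcases ι.symm i with ⟨i₁, i₂⟩ | i₀ <;> rcases ι.symm j with ⟨j₁, j₂⟩ | j₀ <;>
      simp [Matrix.blockDiagonal_apply]
    by_cases hij : i₂ = j₂ <;> simp [hij, h1 i₁ j₁]
  · rw [hap] at h h'
    revert h h'
    rcases ι.symm i with ⟨i₁, i₂⟩ | i₀ <;> rcases ι.symm j with ⟨j₁, j₂⟩ | j₀ <;>
      rcases ι.symm j' with ⟨k₁, k₂⟩ | k₀ <;> simp [Matrix.blockDiagonal_apply]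
    rintro rfl h rfl h'
    exact ⟨h2 _ _ _ h h', rfl⟩
  · rw [hap] at h h'
    revert h h'
    rcases ι.symm i with ⟨i₁, i₂⟩ | i₀ <;> rcases ι.symm j with ⟨j₁, j₂⟩ | j₀ <;>
      rcases ι.symm i' with ⟨k₁, k₂⟩ | k₀ <;> simp [Matrix.blockDiagonal_apply]
    rintro rfl h rfl h'
    exact ⟨h3 _ _ _ h h', rfl⟩

theorem amplify_dim {d₀ q r d : ℕ} (ι : (Fin d₀ × Fin q) ⊕ Fin r ≃ Fin d) : d = d₀ * q + r := by
  simpa using (Fintype.card_congr ι).symm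

/-- The Hilbert–Schmidt sum grows by the factor `q`, the dimension by at least `q`; zero padding
only lowers the normalized norm. -/
theorem normTwo_amplify_le (M : Matrix (Fin d₀) (Fin d₀) ℂ) (hd₀ : 1 ≤ d₀) :
    normTwo (amplify ι M) ≤ normTwo M := by
  have hd := amplify_dim ι
  rw [normTwo, normTwo, ← amplify_conjTranspose, ← amplify_mul, normTrace, normTrace, trace_amplify,
    trace_conjTranspose_mul_self]
  refine Real.sqrt_le_sqrt ?_
  rw [Complex.div_natCast_re, Complex.div_natCast_re, Complex.ofReal_re,
    ← Complex.ofReal_natCast q, ← Complex.ofReal_mul, Complex.ofReal_re]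
  have hs : (0 : ℝ) ≤ ∑ i, ∑ j, ‖M i j‖ ^ 2 := by positivity
  have hd₀' : (0 : ℝ) < d₀ := by exact_mod_cast hd₀
  rcases Nat.eq_zero_or_pos d with h | h
  · simp only [h, Nat.cast_zero, div_zero]
    positivity
  have h' : (0 : ℝ) < d := by exact_mod_cast h
  rw [div_le_div_iff₀ h' hd₀']
  have h4 : (q * d₀ : ℝ) ≤ d := by
    have : q * d₀ ≤ d := by
      rw [hd, mul_comm]
      exact Nat.le_add_right _ _
    exact_mod_cast this
  nlinarith

end Amplification

/-! ### Models in all large dimensions and their orbits under permutations -/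

section ApproximateModels

variable {G : Type*} [MeasurableSpace G] [SetGroupoid G] [DiscreteMeasurableGroupoid G]
variable {μ : Measure (unitSpace G)} [IsFiniteMeasure μ]

theorem SA_mono {F F' : Finset (inverseSemigroup μ)} {n n' d : ℕ} {δ δ' : ℝ} (hF : F ⊆ F')
    (hn : n ≤ n') (hδ : δ' ≤ δ) : SA F' n' δ' d ⊆ SA F n δ d := by
  intro φ hφ l hl hln hlF
  have hsub : symm F ⊆ symm F' := union_subset_union (Finset.coe_subset.2 hF)
    (image_mono (Finset.coe_subset.2 hF))
  obtain ⟨h1, h2, h3⟩ := hφ l hl (hln.trans hn) fun s hs => hsub (hlF s hs)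
  exact ⟨h1.trans_le hδ, h2, h3.trans_le hδ⟩

/-- Amplification with a zero block does not preserve the identity, so only nonempty products can be
used. -/
theorem map_list_prod_of_map_mul {M N : Type*} [Monoid M] [Monoid N] {f : M → N}
    (hf : ∀ a b, f (a * b) = f a * f b) (l : List M) (hl : l ≠ []) :
    f l.prod = (l.map f).prod := by
  induction l with
  | nil => exact absurd rfl hl
  | cons a l ih =>
    rcases eq_or_ne l [] with rfl | h
    · simp
    · rw [List.prod_cons, hf, ih h, List.map_cons, List.prod_cons]

/-- The common mechanism behind amplification, where `η` absorbs the change of trace, and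
conjugation, where `η = 0`. -/
theorem comp_mem_SA {F : Finset (inverseSemigroup μ)} {n d₀ d : ℕ} {δ δ' η : ℝ}
    {φ : linSpan μ →ₗ[ℂ] Matrix (Fin d₀) (Fin d₀) ℂ} (hφ : φ ∈ SA F n δ d₀)
    (Ψ : Matrix (Fin d₀) (Fin d₀) ℂ →ₗ[ℂ] Matrix (Fin d) (Fin d) ℂ)
    (hmul : ∀ M N, Ψ (M * N) = Ψ M * Ψ N) (hnorm : ∀ M, normTwo (Ψ M) ≤ normTwo M)
    (hmem : ∀ M ∈ partialPermMatrices d₀, Ψ M ∈ partialPermMatrices d)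
    (htr : ∀ M ∈ partialPermMatrices d₀, ‖normTrace (Ψ M) - normTrace M‖ ≤ η)
    (hδ : δ + η ≤ δ') (hη : 0 ≤ η) : Ψ.comp φ ∈ SA F n δ' d := by
  intro l hl hln hlF
  obtain ⟨h1, h2, h3⟩ := hφ l hl hln hlF
  have hne : (l.map fun s => φ (toSpan s)) ≠ [] := by
    intro h
    rw [List.map_eq_nil_iff] at h
    simp [h] at hl
  refine ⟨?_, hmem _ h2, ?_⟩
  · have e := map_list_prod_of_map_mul hmul _ hne
    rw [List.map_map] at e
    simp only [LinearMap.comp_apply]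
    rw [show (fun s => Ψ (φ (toSpan s))) = Ψ ∘ fun s => φ (toSpan s) from rfl, ← e, ← map_sub]
    exact ((hnorm _).trans_lt h1).trans_le (by linarith)
  · calc _ ≤ ‖normTrace (Ψ (φ (toSpan l.prod))) - normTrace (φ (toSpan l.prod))‖ +
          ‖normTrace (φ (toSpan l.prod)) - trace μ (l.prod : inverseSemigroup μ).1‖ :=
          norm_sub_le_norm_sub_add_norm_sub _ _ _
      _ < δ' := by
        have := htr _ h2
        linarith

/-- Approximate models of a sofic groupoid exist in all large dimensions. -/
theorem eventually_SA_nonempty (h : IsSofic μ) (F : Finset (inverseSemigroup μ)) (n : ℕ) {δ : ℝ}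
    (hδ : 0 < δ) : ∀ᶠ d in atTop, (SA F n δ d).Nonempty := by
  obtain ⟨d₀, hd₀, φ, hφ⟩ := h F n (δ / 2) (half_pos hδ)
  have hd₀' : (0 : ℝ) < d₀ := by exact_mod_cast hd₀
  filter_upwards [tendsto_natCast_atTop_atTop.eventually_ge_atTop (2 * d₀ / δ : ℝ),
    eventually_ge_atTop 1] with d hd hd1
  have hd' : (0 : ℝ) < d := by exact_mod_cast hd1
  let ι : (Fin d₀ × Fin (d / d₀)) ⊕ Fin (d % d₀) ≃ Fin d :=
    Fintype.equivFinOfCardEq (by simp [Nat.div_add_mod])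
  refine ⟨_, comp_mem_SA hφ (amplify ι) (amplify_mul ι) (fun M => normTwo_amplify_le ι M hd₀)
    (fun M => amplify_mem ι) (η := δ / 2) (fun M hM => ?_) (by linarith) (by linarith)⟩
  -- The trace loses only the proportion `(d % d₀) / d` occupied by the zero block, at most `δ / 2`
  -- once `d ≥ 2 * d₀ / δ`.
  have e : normTrace (amplify ι M) - normTrace M = normTrace M * ((-(d % d₀ : ℕ) : ℝ) / d : ℝ) := by
    have h1 : ((d : ℕ) : ℂ) = d₀ * (d / d₀ : ℕ) + (d % d₀ : ℕ) := by
      exact_mod_cast (Nat.div_add_mod d d₀).symm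
    have h2 : (d : ℂ) ≠ 0 := by exact_mod_cast hd'.ne'
    have h3 : (d₀ : ℂ) ≠ 0 := by exact_mod_cast hd₀'.ne'
    rw [normTrace, normTrace, trace_amplify]
    push_cast
    field_simp
    rw [h1]
    ring
  rw [e, norm_mul]
  refine (mul_le_of_le_one_left (norm_nonneg _) (norm_normTrace_le_one hM)).trans ?_
  rw [Complex.norm_real, Real.norm_eq_abs, abs_div, abs_neg, Nat.abs_cast, Nat.abs_cast,
    div_le_iff₀ hd']
  have h1 : ((d % d₀ : ℕ) : ℝ) ≤ d₀ := by exact_mod_cast (Nat.mod_lt d hd₀).le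
  rw [div_le_iff₀ hδ] at hd
  linarith

theorem normTwo_reindex {d : ℕ} (P : Equiv.Perm (Fin d)) (M : Matrix (Fin d) (Fin d) ℂ) :
    normTwo (Matrix.reindex P P M) = normTwo M := by
  rw [normTwo_eq, normTwo_eq]
  congr 2
  simp only [Matrix.reindex_apply, Matrix.submatrix_apply]
  rw [P.symm.sum_comp fun i => ∑ j, ‖M i (P.symm j)‖ ^ 2]
  exact Finset.sum_congr rfl fun i _ => P.symm.sum_comp fun j => ‖M i j‖ ^ 2

theorem conj_mem_SA {F : Finset (inverseSemigroup μ)} {n d : ℕ} {δ : ℝ}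
    {φ : linSpan μ →ₗ[ℂ] Matrix (Fin d) (Fin d) ℂ} (hφ : φ ∈ SA F n δ d) (P : Equiv.Perm (Fin d)) :
    (Matrix.reindexAlgEquiv ℂ ℂ P).toLinearMap.comp φ ∈ SA F n δ d := by
  refine comp_mem_SA hφ _ (fun M N => map_mul (Matrix.reindexAlgEquiv ℂ ℂ P) M N)
    (fun M => (normTwo_reindex P M).le)
    (fun M hM => submatrix_mem_partialPermMatrices hM P.symm) (η := 0) (fun M _ => ?_)
    (by simp) le_rfl
  have : (Matrix.reindex P P M).trace = M.trace := P.symm.sum_comp fun i => M i i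
  change ‖normTrace (Matrix.reindex P P M) - normTrace M‖ ≤ 0
  rw [normTrace, normTrace, this, sub_self, norm_zero]

/-- The number of restrictions of approximate models is at least the number of conjugates of one of
them. -/
theorem factorial_le_countSA {S : Type*} {E F : Finset (inverseSemigroup μ)} {n d m k : ℕ} {δ : ℝ}
    {φ : linSpan μ →ₗ[ℂ] Matrix (Fin d) (Fin d) ℂ} (hφ : φ ∈ SA F n δ d) {σ : S → inverseSemigroup μ}
    (hσ : ∀ s, σ s ∈ E) (hφσ : ∀ s, φ (toSpan (σ s)) ∈ partialPermMatrices d) (hd : 1 ≤ d)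
    (hm : 1 ≤ m)
    (hbad : {v : Fin d | ¬ ∃ w : Fin m → Fin d, Function.Injective w ∧
      ∀ j, ∃ s, φ (toSpan (σ s)) (w j) v ≠ 0}.ncard ≤ k) :
    ((d.factorial : ℕ) : ℕ∞) ≤ (d ^ (d / m + k) : ℕ) * countSA E F n δ d := by
  classical
  rw [Set.ncard_eq_toFinset_card', Set.toFinset_ofPred] at hbad
  have h := factorial_le_card_conj hd hm hφσ (by convert hbad)
  refine (Nat.cast_le.2 h).trans ?_
  rw [Nat.cast_mul]
  refine mul_le_mul_right ?_ _
  rw [countSA]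
  -- Reading a tuple over `E` along `σ` can only identify restrictions, so the count over `S` is a
  -- lower bound.
  refine le_trans ?_ (encard_image_le
    (fun (x : E → Matrix (Fin d) (Fin d) ℂ) (s : S) => x ⟨σ s, hσ s⟩) _)
  rw [← encard_coe_eq_coe_finsetCard]
  refine encard_le_encard ?_
  intro x hx
  obtain ⟨P, -, rfl⟩ := Finset.mem_image.1 (Finset.mem_coe.1 hx)
  exact ⟨_, ⟨_, conj_mem_SA hφ P, rfl⟩, rfl⟩

end ApproximateModels

/-! ### Asymptotics and assembly of the lower bound -/

section LowerBound

/-- The asymptotic form of a lower bound for `N` by a factorial. -/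
theorem le_log_div_of_factorial_le {c : ℝ} (hc : 0 < c) {d m k : ℕ} {N : ℕ∞} (hd : 1 ≤ d)
    (hlog : 3 / c ≤ Real.log d) (hm : (1 / m : ℝ) ≤ c / 3) (hk : (k : ℝ) ≤ c / 3 * d)
    (h : ((d.factorial : ℕ) : ℕ∞) ≤ (d ^ (d / m + k) : ℕ) * N) :
    ((1 - c : ℝ) : EReal) ≤ ENNReal.log (N : ℝ≥0∞) / ((d * Real.log d : ℝ) : EReal) := by
  have hd' : (0 : ℝ) < d := by exact_mod_cast hd
  have hlog0 : 0 < Real.log d := (by positivity : 0 < 3 / c).trans_le hlog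
  rw [EReal.le_div_iff_mul_le (by exact_mod_cast mul_pos hd' hlog0) (EReal.coe_ne_top _),
    ← EReal.coe_mul, ← Real.log_exp ((1 - c) * (d * Real.log d)),
    ← ENNReal.log_ofReal_of_pos (Real.exp_pos _), ENNReal.log_le_log_iff]
  induction N using ENat.recTopCoe with
  | top => simp
  | coe N =>
    rw [ENat.toENNReal_coe]
    refine ENNReal.ofReal_le_of_le_toReal ?_
    rw [ENNReal.toReal_natCast]
    have h1 : (d.factorial : ℝ) ≤ (d : ℝ) ^ (d / m + k) * N := by exact_mod_cast h
    -- The weak Stirling bound `d ^ d ≤ e ^ d * d!`. The loss `c` splits in thirds: `d / m`, `k`,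
    -- and the factor `e ^ d`, absorbed because `log d ≥ 3 / c`.
    have h2 := Real.pow_div_factorial_le_exp (d : ℝ) hd'.le d
    rw [div_le_iff₀ (by positivity)] at h2
    have hpow : ∀ j : ℕ, (d : ℝ) ^ j = Real.exp (j * Real.log d) := fun j => by
      rw [mul_comm, Real.exp_mul, Real.exp_log hd', Real.rpow_natCast]
    rw [hpow] at h1 h2
    have h3 : ((d / m + k : ℕ) : ℝ) ≤ 2 * c / 3 * d := by
      have h4 : ((d / m : ℕ) : ℝ) ≤ d / m := Nat.cast_div_le
      have h5 : (d / m : ℝ) ≤ c / 3 * d := by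
        rw [div_eq_mul_one_div, mul_comm]
        exact mul_le_mul_of_nonneg_right hm hd'.le
      push_cast
      linarith
    have h6 : (d : ℝ) ≤ c / 3 * (d * Real.log d) := by
      rw [div_le_iff₀ hc] at hlog
      nlinarith
    have h7 : Real.exp (d * Real.log d) ≤
        Real.exp (d + (d / m + k : ℕ) * Real.log d) * N := by
      rw [Real.exp_add, mul_assoc]
      exact h2.trans (mul_le_mul_of_nonneg_left h1 (Real.exp_pos _).le)
    have h8 : (d : ℝ) + (d / m + k : ℕ) * Real.log d ≤ c * (d * Real.log d) := by
      have := mul_le_mul_of_nonneg_right h3 hlog0.le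
      nlinarith
    have h9 : Real.exp (d * Real.log d) ≤ Real.exp (c * (d * Real.log d)) * N :=
      h7.trans (mul_le_mul_of_nonneg_right (Real.exp_le_exp.2 h8) (Nat.cast_nonneg N))
    have e : (1 - c) * (d * Real.log d) = d * Real.log d - c * (d * Real.log d) := by ring
    rw [e, Real.exp_sub, div_le_iff₀ (Real.exp_pos _), mul_comm (N : ℝ)]
    exact h9

variable {G : Type*} [MeasurableSpace G] [SetGroupoid G] [DiscreteMeasurableGroupoid G]

/-- The element `s_B` of `I_G`. -/
noncomputable def Bisection.toInverseSemigroup (μ : Measure (unitSpace G)) [IsFiniteMeasure μ]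
    (B : Bisection G) : inverseSemigroup μ := ⟨B.toOperator μ, B, rfl⟩

theorem exists_one_sub_lt_accumulate (μ : Measure (unitSpace G)) [IsProbabilityMeasure μ]
    {Y : ℕ → Set (unitSpace G)} (hc : ∀ᵐ x ∂μ, x ∈ ⋃ n, Y n) {ε : ℝ} (hε : 0 < ε) :
    ∃ K, 1 - ε < (μ (accumulate Y K)).toReal := by
  have h1 : μ (⋃ n, Y n) = 1 := by
    have hu : (⋃ n, Y n) =ᵐ[μ] univ := eventuallyEq_univ.2 hc
    rw [measure_congr hu, measure_univ]
  have h2 := tendsto_measure_iUnion_accumulate (μ := μ) (f := Y)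
  rw [h1] at h2
  have h3 := (ENNReal.tendsto_toReal ENNReal.one_ne_top).comp h2
  exact (h3.eventually (lt_mem_nhds (by simpa using hε))).exists

set_option maxHeartbeats 1000000 in
/-- For a suitable finite set `E` of partial isometries given by disjoint bisections, most points of
every good approximate model have many images under `E`, so that the model has many conjugates. -/
theorem exists_finset_lowerDimOf_ge (μ : Measure (unitSpace G)) [IsPMP μ]
    (hsofic : IsSofic μ) (hinf : HasInfiniteClasses μ) {c : ℝ} (hc : 0 < c) :
    ∃ E : Finset (inverseSemigroup μ), ∀ F, ((1 - c : ℝ) : EReal) ≤ lowerDimOf E F := by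
  classical
  obtain ⟨m, hm1, hm⟩ : ∃ m : ℕ, 1 ≤ m ∧ (1 / m : ℝ) ≤ c / 3 := by
    obtain ⟨m, hm⟩ := exists_nat_one_div_lt (show 0 < c / 3 by positivity)
    exact ⟨m + 1, by omega, by exact_mod_cast hm.le⟩
  obtain ⟨Y, C, hYm, hYd, hYc, hCY, hCd⟩ := exists_disjoint_bisections μ hinf m
  obtain ⟨K, hK⟩ := exists_one_sub_lt_accumulate μ hYc (show 0 < c / 9 by positivity)
  let κ := Finset.range (K + 1)
  let σ : κ × Fin m → inverseSemigroup μ := fun s => (C s.1 s.2).toInverseSemigroup μ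
  let Z := (Bisection.ofUnits (accumulate Y K) (Bisection.measurableSet_accumulate hYm K))
  let E : Finset (inverseSemigroup μ) := Finset.univ.image σ
  have hσE : ∀ s, σ s ∈ E := fun s => Finset.mem_image_of_mem σ (Finset.mem_univ s)
  refine ⟨E, fun F => le_iInf₂ fun n _ => le_iInf₂ fun δ hδ => ?_⟩
  -- The coefficient of the model error in `card_few_images_le`; `η` is chosen so that the uncovered
  -- measure, the trace error and `L * η` each cost at most `c / 9`, in total `c / 3`.
  let L : ℝ := Fintype.card κ * (m + m * (m * 2))
  have hL : 0 ≤ L := by positivity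
  obtain ⟨η, hη0, hη1, hηδ, hηc, hηL⟩ :
      ∃ η : ℝ, 0 < η ∧ η ≤ 1 ∧ η ≤ δ ∧ η ≤ c / 9 ∧ L * η ≤ c / 9 := by
    refine ⟨min (min 1 δ) (c / 9 / (1 + L)), by positivity,
      (min_le_left _ _).trans (min_le_left _ _), (min_le_left _ _).trans (min_le_right _ _),
      (min_le_right _ _).trans (div_le_self (by positivity) (by linarith)), ?_⟩
    calc _ ≤ L * (c / 9 / (1 + L)) := mul_le_mul_of_nonneg_left (min_le_right _ _) hL
      _ ≤ (1 + L) * (c / 9 / (1 + L)) := mul_le_mul_of_nonneg_right (by linarith) (by positivity)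
      _ = c / 9 := by field_simp
  -- `E` was fixed before `F`; only the model has to respect the larger `F'`. Words of length `2`
  -- suffice for the relations, hence `max n 2` below.
  let F' := insert (Z.toInverseSemigroup μ) (F ∪ E)
  refine le_liminf_of_le (by isBoundedDefault) ?_
  filter_upwards [eventually_SA_nonempty hsofic F' (max n 2) hη0, eventually_ge_atTop 1,
    (Real.tendsto_log_atTop.comp tendsto_natCast_atTop_atTop).eventually_ge_atTop (3 / c)]
    with d hSA hd hlog
  obtain ⟨φ, hφ⟩ := hSA
  have hd' : (0 : ℝ) < d := by exact_mod_cast hd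
  have hF : F ⊆ F' := fun s hs => Finset.mem_insert_of_mem (Finset.mem_union_left _ hs)
  have hσF : ∀ s, σ s ∈ symm F' := fun s =>
    Or.inl (Finset.mem_coe.2 (Finset.mem_insert_of_mem (Finset.mem_union_right _ (hσE s))))
  have hσF' : ∀ s, star (σ s) ∈ symm F' := fun s =>
    Or.inr ⟨σ s, Finset.mem_coe.2 (Finset.mem_insert_of_mem (Finset.mem_union_right _ (hσE s))), rfl⟩
  have h1 : ∀ s ∈ symm F', φ (toSpan s) ∈ partialPermMatrices d ∧
      ‖normTrace (φ (toSpan s)) - trace μ s.1‖ < η := by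
    intro s hs
    have := hφ [s] (by simp) (by simp) (by simpa using hs)
    rw [List.prod_singleton] at this
    exact this.2
  have h2 : ∀ s ∈ symm F', ∀ t ∈ symm F', normTwo (φ (toSpan (s * t)) - φ (toSpan s) * φ (toSpan t)) < η ∧
      φ (toSpan (s * t)) ∈ partialPermMatrices d ∧
      ‖normTrace (φ (toSpan (s * t))) - trace μ (s * t).1‖ < η := by
    intro s hs t ht
    have := hφ [s, t] (by simp) (by simp) (by simp [hs, ht])
    simpa using this
  have hstar : ∀ s t, (star (σ s) * σ t).1 =
      (((C s.1 s.2).inverse.prod (C t.1 t.2)).toOperator μ) := fun s t => by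
    rw [Bisection.toOperator_prod, Bisection.toOperator_inverse]
    rfl
  let p : κ → inverseSemigroup μ := fun t =>
    (Bisection.ofUnits (Y t) (hYm t)).toInverseSemigroup μ
  have hp : ∀ t j, star (σ (t, j)) * σ (t, j) = p t := fun t j => Subtype.ext (by
    rw [hstar, Bisection.inverse_prod_self (hYm t) (hCY t j)]
    rfl)
  have hZ := h1 (Z.toInverseSemigroup μ) (Or.inl (Finset.mem_coe.2 (Finset.mem_insert_self _ _)))
  -- In `ε`, the term `c / 9` is the part of the unit space left uncovered and `η` the error of the
  -- model in the trace of `Z`.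
  have hbad := card_few_images_le (κ := κ) (m := m) (ε := c / 9 + η) hd hη1
    (y := φ (toSpan (Z.toInverseSemigroup μ))) (p := fun t => φ (toSpan (p t)))
    (a := fun t j => φ (toSpan (σ (t, j)))) (b := fun t j => φ (toSpan (star (σ (t, j)))))
    (e := fun t i j => φ (toSpan (star (σ (t, i)) * σ (t, j))))
    hZ.1
    (fun t => by
      rw [← hp t ⟨0, hm1⟩]
      exact (h2 _ (hσF' _) _ (hσF _)).2.1)
    (fun t j => (h1 _ (hσF _)).1) (fun t j => (h1 _ (hσF' _)).1)
    (fun t i j => (h2 _ (hσF' _) _ (hσF _)).2.1)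
    (by
      rw [← map_sum]
      congr 1
      refine Subtype.ext ?_
      rw [AddSubmonoidClass.coe_finsetSum]
      refine (Bisection.toOperator_ofUnits_accumulate μ hYm hYd K).trans ?_
      exact (Finset.sum_coe_sort (Finset.range (K + 1)) fun n =>
        (Bisection.ofUnits (Y n) (hYm n)).toOperator μ).symm)
    (by
      have h3 := hZ.2
      rw [show trace μ (Z.toInverseSemigroup μ).1 = ((μ (accumulate Y K)).toReal : ℂ) from
        Bisection.trace_ofUnits μ _] at h3
      have h4 := (Complex.abs_re_le_norm _).trans h3.le
      rw [Complex.sub_re, Complex.ofReal_re] at h4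
      have := (abs_le.1 h4).1
      linarith)
    (fun t j => by
      rw [← hp t j]
      exact (h2 _ (hσF' _) _ (hσF _)).1)
    (fun t i j => (h2 _ (hσF' _) _ (hσF _)).1)
    (fun t i j hij => by
      have h3 := (h2 _ (hσF' (t, i)) _ (hσF (t, j))).2.2
      rwa [hstar, Bisection.trace_toOperator,
        Bisection.inverse_prod_inter_unitSpace (hCd t i j hij), measure_empty,
        ENNReal.toReal_zero, Complex.ofReal_zero, sub_zero] at h3)
  refine le_log_div_of_factorial_le (k := ⌊c / 3 * d⌋₊) hc hd hlog hm
    (Nat.floor_le (by positivity))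
    (factorial_le_countSA (SA_mono hF (le_max_left n 2) hηδ hφ) hσE (fun s => (h1 _ (hσF s)).1) hd
      hm1 ?_)
  rw [Nat.le_floor_iff (by positivity), Set.ncard_eq_toFinset_card', Set.toFinset_ofPred]
  refine le_trans ?_ (hbad.trans (mul_le_mul_of_nonneg_right ?_ hd'.le))
  · exact le_of_eq (by congr)
  · have e : (Fintype.card κ * (m * η + m * (m * (2 * η))) : ℝ) = L * η := by
      simp only [L]
      ring
    rw [e]
    linarith

end LowerBound

end SoficDim

theorem mainTheorem8 {G : Type*} [MeasurableSpace G] [SoficDim.SetGroupoid G]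
    [SoficDim.DiscreteMeasurableGroupoid G] (μ : Measure (SoficDim.unitSpace G)) [SoficDim.IsPMP μ]
    (hsofic : SoficDim.IsSofic μ) (hinf : SoficDim.HasInfiniteClasses μ) :
    1 ≤ SoficDim.lowerSoficDim μ := by
  by_contra! h
  obtain ⟨z, hz, hz1⟩ := EReal.lt_iff_exists_real_btwn.1 h
  have hz1' : z < 1 := by exact_mod_cast hz1
  -- With `c = 1 - z`, a single `E` already gives the value `z`, strictly above the supposed
  -- supremum.
  obtain ⟨E, hE⟩ := SoficDim.exists_finset_lowerDimOf_ge μ hsofic hinf (sub_pos.2 hz1')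
  rw [sub_sub_cancel] at hE
  refine hz.not_ge ?_
  rw [SoficDim.lowerSoficDim, SoficDim.lowerDim]
  exact le_iSup₂_of_le E (subset_univ _) (le_iInf₂ fun F _ => hE F)
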